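/- Let $X$ be a set and let $G$ be a group generated by $X$ via a map $\iota\colon X\to G$ (not necessarily injective). The Cayley graph $\Gamma_X$ of $G$ has vertex set $G$ and, for every $g\in G$ and every letter $a\in X\cup X^{-1}$ (with $X^{-1}$ a set of formal inverses), an edge labelled $a$ from $g$ to $ga_G$, where $a_G\in G$ is the value of $a$; its inverse edge is the edge labelled $a^{-1}$ from $ga_G$ to $g$. A subgraph is a set of vertices and edges closed under taking endpoints and inverse edges. Let $\operatorname{Sub}\Gamma_X$ be the poset of all subgraphs (including the empty one) and $\operatorname{CSub}\Gamma_X$ the poset of connected (nonempty) subgraphs, both ordered by inclusion; $G$ acts on both by left translation. A closure operator $c$ on $P=\operatorname{Sub}\Gamma_X$ or $P=\operatorname{CSub}\Gamma_X$ is an extensive, monotone and idempotent map $\Delta\mapsto\Delta^c$; it is $G$-invariant if $(g\Delta)^c=g(\Delta^c)$ for all $g\in G$ and $\Delta\in P$, and finitary if $\Delta^c=\bigcup\{F^c : F\in P,\ F\subseteq\Delta,\ F\text{ finite}\}$ for all $\Delta\in P$. Let $\mathcal C(X,G)$ be the category of $G$-invariant finitary closure operators on $\operatorname{CSub}\Gamma_X$,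 and $\mathcal S(X,G)$ the category of $G$-invariant finitary closure operators on $\operatorname{Sub}\Gamma_X$ for which the empty subgraph is closed; in both, there is a (single) morphism $c\to c'$ exactly when $\Delta^c\subseteq\Delta^{c'}$ for all $\Delta\in P$. For an inverse monoid $S$ let $\sigma$ be its least congruence whose quotient is a group. $S$ is $E$-unitary if the $\sigma$-class of $1$ consists exactly of the idempotents of $S$, and $S$ is $F$-inverse if every $\sigma$-class has a greatest element in the natural partial order; then $s^{\mathfrak m}$ denotes the greatest element of the $\sigma$-class of $s$. A monoid $S$ of either kind, with a map $\iota_S\colon X\to S$, has greatest group image $G$ if there is a surjective homomorphism $\pi\colon S\to G$ with kernel $\sigma$ and $\pi\circ\iota_S=\iota$. Let $\mathcal E(X,G)$ be the category of $E$-unitary inverse monoids that are $X$-generated in the signature $(\cdot,1,{}^{-1})$ and have greatest group image $G$, and $\mathcal F(X,G)$ the category of $F$-inverse monoids that are $X$-generated in the signature $(\cdot,1,{}^{-1},{}^{\mathfrak m})$ and have greatest group image $G$; in both, the morphisms $S\to T$ are the homomorphisms $\varphi$ in the respective signature with $\varphi\circ\iota_S=\iota_T$. Then: 1. the categories $\mathcal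 E(X,G)$ and $\mathcal C(X,G)$ are equivalent; 2. the categories $\mathcal F(X,G)$ and $\mathcal S(X,G)$ are equivalent. -/

import Mathlib

open CategoryTheory

universe u v

/-- An inverse monoid, in the signature `(·, 1, ⁻¹)`: every `a` has a unique inverse `a⁻¹`, i.e. a
unique element `b` with `a * b * a = a` and `b * a * b = b`. -/
class InverseMonoid (S : Type u) extends Monoid S, Inv S where
  mul_inv_mul : ∀ a : S, a * a⁻¹ * a = a
  inv_mul_inv : ∀ a : S, a⁻¹ * a * a⁻¹ = a⁻¹
  inv_unique : ∀ a b : S, a * b * a = a → b * a * b = b → b = a⁻¹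

namespace InverseMonoid

/-- The natural partial order of an inverse monoid. -/
def NatLE {S : Type u} [InverseMonoid S] (a b : S) : Prop := a = a * a⁻¹ * b

/-- A congruence on an inverse monoid whose quotient is a group (with the class of `s⁻¹` as the
group inverse of the class of `s`). -/
def IsGroupCon {S : Type u} [InverseMonoid S] (c : Con S) : Prop :=
  ∀ s : S, c (s * s⁻¹) 1 ∧ c (s⁻¹ * s) 1

/-- The congruence `σ`: the least congruence whose quotient is a group. -/
def sigma (S : Type u) [InverseMonoid S] : Con S := sInf {c : Con S | IsGroupCon c}

/-- `S` is `E`-unitary: the greatest group morphism `S → S/σ` is idempotent pure, i.e. the preimage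
of `1` is the set of idempotents. -/
def IsEUnitary (S : Type u) [InverseMonoid S] : Prop :=
  ∀ s : S, sigma S s 1 ↔ s * s = s

/-- `S` is generated by `ι(X)` in the signature `(·, 1, ⁻¹)`: the only subset containing `ι(X)`
and closed under the operations is `S` itself. -/
def IsGeneratedBy {X : Type u} {S : Type v} [InverseMonoid S] (ι : X → S) : Prop :=
  ∀ T : Set S, (∀ x, ι x ∈ T) → 1 ∈ T → (∀ a ∈ T, ∀ b ∈ T, a * b ∈ T) → (∀ a ∈ T, a⁻¹ ∈ T) →
    T = Set.univ

/-- The morphism `π : S → G` onto a group is the natural morphism onto the greatest group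
image of `S`: it is onto, and its kernel is `σ`. -/
def IsGreatestGroupImage {S : Type u} [InverseMonoid S] {G : Type v} [Group G] (π : S →* G) :
    Prop :=
  Function.Surjective π ∧ ∀ a b : S, π a = π b ↔ sigma S a b

end InverseMonoid

/-- An `F`-inverse monoid, in the signature `(·, 1, ⁻¹, ᵐ)`: an inverse monoid in which every
`σ`-class has a greatest element for the natural partial order; `maxElt a` is the greatest element
of the `σ`-class of `a`. -/
class FInverseMonoid (S : Type u) extends InverseMonoid S where
  maxElt : S → S
  maxElt_sigma : ∀ a : S, InverseMonoid.sigma S (maxElt a) a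
  le_maxElt : ∀ a b : S, InverseMonoid.sigma S b a → InverseMonoid.NatLE b (maxElt a)

/-- `S` is generated by `ι(X)` in the signature `(·, 1, ⁻¹, ᵐ)`. -/
def FInverseMonoid.IsGeneratedBy {X : Type u} {S : Type v} [FInverseMonoid S] (ι : X → S) : Prop :=
  ∀ T : Set S, (∀ x, ι x ∈ T) → 1 ∈ T → (∀ a ∈ T, ∀ b ∈ T, a * b ∈ T) → (∀ a ∈ T, a⁻¹ ∈ T) →
    (∀ a ∈ T, FInverseMonoid.maxElt a ∈ T) → T = Set.univ

/-! ### The category of `X`-generated `E`-unitary inverse monoids with greatest group image `G` -/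

/-- An `X`-generated `E`-unitary inverse monoid with greatest group image the `X`-generated
group `(G, ι)`; the natural morphism onto `G` is canonical, i.e. respects the generators. -/
structure EUnitaryOver {X : Type u} {G : Type v} [Group G] (ι : X → G) where
  carrier : Type (max u v)
  [inverseMonoid : InverseMonoid carrier]
  gen : X → carrier
  generated : InverseMonoid.IsGeneratedBy gen
  eUnitary : InverseMonoid.IsEUnitary carrier
  proj : carrier →* G
  proj_gen : ∀ x, proj (gen x) = ι x
  proj_greatest : InverseMonoid.IsGreatestGroupImage proj

namespace EUnitaryOver

attribute [instance] EUnitaryOver.inverseMonoid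

variable {X : Type u} {G : Type v} [Group G] {ι : X → G}

/-- A canonical homomorphism of inverse monoids. -/
@[ext]
structure Hom (S T : EUnitaryOver ι) where
  toMonoidHom : S.carrier →* T.carrier
  map_inv : ∀ a, toMonoidHom a⁻¹ = (toMonoidHom a)⁻¹
  map_gen : ∀ x, toMonoidHom (S.gen x) = T.gen x

instance : Category (EUnitaryOver ι) where
  Hom S T := Hom S T
  id S := ⟨MonoidHom.id _, fun _ => rfl, fun _ => rfl⟩
  comp f g := ⟨g.toMonoidHom.comp f.toMonoidHom,
    fun a => by simp [f.map_inv, g.map_inv],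
    fun x => by simp [f.map_gen, g.map_gen]⟩

end EUnitaryOver

/-! ### The category of `X`-generated `F`-inverse monoids with greatest group image `G` -/

/-- An `F`-inverse monoid, `X`-generated in the signature `(·, 1, ⁻¹, ᵐ)`, with greatest group
image the `X`-generated group `(G, ι)`. -/
structure FInverseOver {X : Type u} {G : Type v} [Group G] (ι : X → G) where
  carrier : Type (max u v)
  [fInverseMonoid : FInverseMonoid carrier]
  gen : X → carrier
  generated : FInverseMonoid.IsGeneratedBy gen
  proj : carrier →* G
  proj_gen : ∀ x, proj (gen x) = ι x
  proj_greatest : InverseMonoid.IsGreatestGroupImage proj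

namespace FInverseOver

attribute [instance] FInverseOver.fInverseMonoid

variable {X : Type u} {G : Type v} [Group G] {ι : X → G}

/-- A canonical homomorphism of `F`-inverse monoids. -/
@[ext]
structure Hom (S T : FInverseOver ι) where
  toMonoidHom : S.carrier →* T.carrier
  map_inv : ∀ a, toMonoidHom a⁻¹ = (toMonoidHom a)⁻¹
  map_maxElt : ∀ a, toMonoidHom (FInverseMonoid.maxElt a) = FInverseMonoid.maxElt (toMonoidHom a)
  map_gen : ∀ x, toMonoidHom (S.gen x) = T.gen x

instance : Category (FInverseOver ι) where
  Hom S T := Hom S T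
  id S := ⟨MonoidHom.id _, fun _ => rfl, fun _ => rfl, fun _ => rfl⟩
  comp f g := ⟨g.toMonoidHom.comp f.toMonoidHom,
    fun a => by simp [f.map_inv, g.map_inv],
    fun a => by simp [f.map_maxElt, g.map_maxElt],
    fun x => by simp [f.map_gen, g.map_gen]⟩

end FInverseOver

/-! ### The Cayley graph and its subgraphs -/

namespace Cayley

variable {X : Type u} {G : Type v} [Group G]

/-- The value in `G` of a letter of `X ∪ X⁻¹`; `(x, true)` stands for `x` and `(x, false)` for the
formal inverse `x⁻¹`. -/
def letterVal (ι : X → G) (a : X × Bool) : G := if a.2 then ι a.1 else (ι a.1)⁻¹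

/-- The edges of the Cayley graph: `(g, a)` is the edge with label `a` starting at `g`. -/
abbrev Edge (_ : X → G) : Type (max u v) := G × (X × Bool)

/-- The initial vertex of an edge. -/
def Edge.source {ι : X → G} (e : Edge ι) : G := e.1

/-- The terminal vertex of an edge. -/
def Edge.target {ι : X → G} (e : Edge ι) : G := e.1 * letterVal ι e.2

/-- The inverse of an edge. -/
def Edge.inverse {ι : X → G} (e : Edge ι) : Edge ι := (Edge.target e, (e.2.1, !e.2.2))

/-- The left action of `G` on edges. -/
def Edge.translate {ι : X → G} (g : G) (e : Edge ι) : Edge ι := (g * e.1, e.2)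

/-- A subgraph of the Cayley graph: a set of vertices and a set of edges, closed under taking
initial and terminal vertices and inverse edges. The empty subgraph is allowed. -/
@[ext]
structure Sub (ι : X → G) where
  verts : Set G
  edges : Set (Edge ι)
  source_mem : ∀ e ∈ edges, Edge.source e ∈ verts
  target_mem : ∀ e ∈ edges, Edge.target e ∈ verts
  inverse_mem : ∀ e ∈ edges, Edge.inverse e ∈ edges

namespace Sub

variable {ι : X → G}

/-- Subgraphs are ordered by inclusion. -/
instance : PartialOrder (Sub ι) where
  le A B := A.verts ⊆ B.verts ∧ A.edges ⊆ B.edges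
  le_refl _ := ⟨subset_rfl, subset_rfl⟩
  le_trans _ _ _ h k := ⟨h.1.trans k.1, h.2.trans k.2⟩
  le_antisymm _ _ h k := Sub.ext (h.1.antisymm k.1) (h.2.antisymm k.2)

/-- The empty subgraph. -/
def empty (ι : X → G) : Sub ι where
  verts := ∅
  edges := ∅
  source_mem _ h := h.elim
  target_mem _ h := h.elim
  inverse_mem _ h := h.elim

/-- A subgraph is finite if it has finitely many vertices and edges. -/
def IsFinite (A : Sub ι) : Prop := A.verts.Finite ∧ A.edges.Finite

/-- The image `gΔ` of a subgraph `Δ` under the left action of `g`. -/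
def translate (g : G) (A : Sub ι) : Sub ι where
  verts := (fun v => g * v) '' A.verts
  edges := Edge.translate g '' A.edges
  source_mem := by
    rintro _ ⟨e, he, rfl⟩
    exact ⟨_, A.source_mem e he, rfl⟩
  target_mem := by
    rintro _ ⟨e, he, rfl⟩
    exact ⟨_, A.target_mem e he, by simp [Edge.target, Edge.translate, mul_assoc]⟩
  inverse_mem := by
    rintro _ ⟨e, he, rfl⟩
    exact ⟨_, A.inverse_mem e he, by
      simp [Edge.target, Edge.translate, Edge.inverse, mul_assoc]⟩

/-- There is an edge of the subgraph from `g` to `h`. -/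
def Step (A : Sub ι) (g h : G) : Prop := ∃ e ∈ A.edges, Edge.source e = g ∧ Edge.target e = h

/-- A subgraph is connected if it is nonempty and any two of its vertices are joined by a
(possibly empty) path in it. -/
def IsConnected (A : Sub ι) : Prop :=
  A.verts.Nonempty ∧ ∀ g ∈ A.verts, ∀ h ∈ A.verts, Relation.ReflTransGen A.Step g h

theorem IsConnected.translate {A : Sub ι} (hA : A.IsConnected) (g : G) :
    (A.translate g).IsConnected := by
  refine ⟨hA.1.image _, ?_⟩
  rintro _ ⟨a, ha, rfl⟩ _ ⟨b, hb, rfl⟩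
  refine Relation.ReflTransGen.lift (fun v => g * v) ?_ _ _ (hA.2 a ha b hb)
  rintro _ _ ⟨e, he, rfl, rfl⟩
  exact ⟨_, ⟨e, he, rfl⟩, rfl, by simp [Edge.target, Edge.translate, mul_assoc]⟩

end Sub

/-- The poset of connected subgraphs of the Cayley graph. -/
abbrev CSub (ι : X → G) : Type (max u v) := {A : Sub ι // A.IsConnected}

/-- The image `gΔ` of a connected subgraph `Δ` under the left action of `g`. -/
def CSub.translate {ι : X → G} (g : G) (A : CSub ι) : CSub ι := ⟨A.1.translate g, A.2.translate g⟩

/-! ### The categories of closure operators -/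

/-- A `G`-invariant, finitary closure operator on the poset of connected subgraphs. -/
structure IsInvFinitaryC {ι : X → G} (c : ClosureOperator (CSub ι)) : Prop where
  invariant : ∀ (g : G) (A : CSub ι), c (A.translate g) = (c A).translate g
  finitary_verts : ∀ A : CSub ι,
    (c A).1.verts = ⋃ F ∈ {F : CSub ι | F ≤ A ∧ F.1.IsFinite}, (c F).1.verts
  finitary_edges : ∀ A : CSub ι,
    (c A).1.edges = ⋃ F ∈ {F : CSub ι | F ≤ A ∧ F.1.IsFinite}, (c F).1.edges

/-- A `G`-invariant, finitary closure operator on the poset of all subgraphs, for which the empty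
subgraph is closed. -/
structure IsInvFinitaryS {ι : X → G} (c : ClosureOperator (Sub ι)) : Prop where
  invariant : ∀ (g : G) (A : Sub ι), c (A.translate g) = (c A).translate g
  finitary_verts : ∀ A : Sub ι,
    (c A).verts = ⋃ F ∈ {F : Sub ι | F ≤ A ∧ F.IsFinite}, (c F).verts
  finitary_edges : ∀ A : Sub ι,
    (c A).edges = ⋃ F ∈ {F : Sub ι | F ≤ A ∧ F.IsFinite}, (c F).edges
  closed_empty : c (Sub.empty ι) = Sub.empty ι

/-- The `G`-invariant, finitary closure operators on connected subgraphs. -/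
def ClosureC (ι : X → G) : Type (max u v) := {c : ClosureOperator (CSub ι) // IsInvFinitaryC c}

/-- The `G`-invariant, finitary closure operators on all subgraphs fixing the empty subgraph. -/
def ClosureS (ι : X → G) : Type (max u v) := {c : ClosureOperator (Sub ι) // IsInvFinitaryS c}

/-- There is a (unique) morphism from `c` to `c'` iff `Δ^c ⊆ Δ^c'` for every connected subgraph
`Δ`. -/
instance (ι : X → G) : Preorder (ClosureC ι) where
  le c c' := ∀ A : CSub ι, c.1 A ≤ c'.1 A
  le_refl _ _ := le_rfl
  le_trans _ _ _ h k A := (h A).trans (k A)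

/-- There is a (unique) morphism from `c` to `c'` iff `Δ^c ⊆ Δ^c'` for every subgraph `Δ`. -/
instance (ι : X → G) : Preorder (ClosureS ι) where
  le c c' := ∀ A : Sub ι, c.1 A ≤ c'.1 A
  le_refl _ _ := le_rfl
  le_trans _ _ _ h k A := (h A).trans (k A)

end Cayley

/-! Both equivalences come from one argument about a property `Q` of subgraphs: connectedness for
`E`-unitary monoids, nonemptiness for `F`-inverse ones (`Admissible`).

A closure operator `c` yields the monoid of pairs `(F^c, g)`, where `F` is finite, satisfies `Q` and
contains `1` and `g`, with product `(A, g)(B, h) = ((A ∪ gB)^c, gh)`. Elements over `1` are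
idempotent. If edgeless graphs on `{1, g}` are allowed, they give the greatest elements over each
`g`.

Conversely, let `π : S → G` be idempotent pure. An idempotent `e` has a Schützenberger graph inside
the Cayley graph, with vertices `π t` for `e ≤ t t⁻¹`. If `F` is finite, satisfies `Q` and contains
`1`, there is a largest idempotent whose graph contains `F` (`Covers`), and that graph is the
closure of `F`. Translation and finitarity extend this to all subgraphs satisfying `Q`
(`IsModel.closure`). The map `s ↦ (graph (s s⁻¹), π s)` identifies `S` with the monoid of its own
closure operator (`IsModel.toMon_bijective`).

The engine is `Multiplicative.induction`: pointed finite subgraphs are generated under `A ∪ gB` by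
single edges and admissible edgeless pairs. It gives generation of the monoid, existence of covering
idempotents, and rigidity of morphisms. Since `H ⊆ F^c` says that `F` and `F ∪ H` define the same
element, a morphism exists exactly when `c ≤ c'` (`GClosure.map`, `GClosure.le_of_hom`). Hence the
functor from closure operators to monoids is fully faithful and essentially surjective. -/

namespace InverseMonoid

/-! ### Idempotents, domains and `σ` in an inverse monoid -/

section Basic

variable {S : Type u} [InverseMonoid S]

theorem inv_inv (a : S) : a⁻¹⁻¹ = a :=
  (inv_unique a⁻¹ a (inv_mul_inv a) (mul_inv_mul a)).symm

theorem inv_eq_of_idem {e : S} (he : e * e = e) : e⁻¹ = e :=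
  (inv_unique e e (by rw [he, he]) (by rw [he, he])).symm

/-- With `x = (e f)⁻¹`, the element `f x e` is another inverse of `e f`, so `x = f x e`. This makes
`x` idempotent, hence its own inverse, and `e f = x⁻¹ = x`. -/
theorem idem_mul_idem {e f : S} (he : e * e = e) (hf : f * f = f) : (e * f) * (e * f) = e * f := by
  have h1 := mul_inv_mul (e * f)
  have h2 := inv_mul_inv (e * f)
  set x := (e * f)⁻¹ with hx
  have h3 : f * x * e = x := by
    apply inv_unique (e * f) (f * x * e)
    · calc e * f * (f * x * e) * (e * f) = e * (f * f) * x * (e * e) * f := by simp only [mul_assoc]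
        _ = e * f * x * (e * f) := by rw [he, hf]; simp only [mul_assoc]
        _ = e * f := h1
    · calc f * x * e * (e * f) * (f * x * e) = f * x * (e * e) * (f * f) * x * e := by
            simp only [mul_assoc]
        _ = f * (x * (e * f) * x) * e := by rw [he, hf]; simp only [mul_assoc]
        _ = f * x * e := by rw [h2]
  have h4 : x * x = x := by
    calc x * x = (f * x * e) * (f * x * e) := by rw [h3]
      _ = f * (x * (e * f) * x) * e := by simp only [mul_assoc]
      _ = x := by rw [h2, h3]
  have h5 : e * f = x := by
    rw [← inv_inv (e * f), ← hx, inv_eq_of_idem h4]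
  rw [h5, h4]

/-- As `e f` and `f e` are idempotent, `f e` is an inverse of `e f`; but `e f` is its own inverse.
-/
theorem idem_comm {e f : S} (he : e * e = e) (hf : f * f = f) : e * f = f * e := by
  have h1 := idem_mul_idem he hf
  have h2 := idem_mul_idem hf he
  have h3 : f * e = (e * f)⁻¹ := by
    apply inv_unique
    · calc e * f * (f * e) * (e * f) = e * (f * f) * (e * e) * f := by simp only [mul_assoc]
        _ = e * f * (e * f) := by rw [he, hf]; simp only [mul_assoc]
        _ = e * f := h1
    · calc f * e * (e * f) * (f * e) = f * (e * e) * (f * f) * e := by simp only [mul_assoc]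
        _ = f * e * (f * e) := by rw [he, hf]; simp only [mul_assoc]
        _ = f * e := h2
  rw [h3, inv_eq_of_idem h1]

/-- The idempotent `s * s⁻¹`, the domain of `s`. -/
def src (s : S) : S := s * s⁻¹

theorem src_idem (s : S) : src s * src s = src s := by
  simp only [src]; rw [← mul_assoc, mul_inv_mul]

theorem inv_mul_idem (s : S) : (s⁻¹ * s) * (s⁻¹ * s) = s⁻¹ * s := by
  rw [← mul_assoc, inv_mul_inv]

theorem src_mul (s : S) : src s * s = s := mul_inv_mul s

theorem src_inv (s : S) : src s⁻¹ = s⁻¹ * s := by rw [src, inv_inv]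

theorem src_of_idem {e : S} (he : e * e = e) : src e = e := by
  rw [src, inv_eq_of_idem he, he]

theorem one_inv : (1 : S)⁻¹ = 1 := inv_eq_of_idem (mul_one 1)

theorem src_one : src (1 : S) = 1 := src_of_idem (mul_one 1)

theorem mul_inv_rev (a b : S) : (a * b)⁻¹ = b⁻¹ * a⁻¹ := by
  have hc := idem_comm (src_idem b) (inv_mul_idem a)
  rw [src] at hc
  symm
  apply inv_unique
  · calc a * b * (b⁻¹ * a⁻¹) * (a * b) = a * ((b * b⁻¹) * (a⁻¹ * a)) * b := by
          simp only [mul_assoc]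
      _ = (a * a⁻¹ * a) * (b * b⁻¹ * b) := by rw [hc]; simp only [mul_assoc]
      _ = a * b := by rw [mul_inv_mul, mul_inv_mul]
  · calc b⁻¹ * a⁻¹ * (a * b) * (b⁻¹ * a⁻¹) = b⁻¹ * ((a⁻¹ * a) * (b * b⁻¹)) * a⁻¹ := by
          simp only [mul_assoc]
      _ = (b⁻¹ * b * b⁻¹) * (a⁻¹ * a * a⁻¹) := by rw [← hc]; simp only [mul_assoc]
      _ = b⁻¹ * a⁻¹ := by rw [inv_mul_inv, inv_mul_inv]

theorem src_mul_eq (s t : S) : src (s * t) = s * src t * s⁻¹ := by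
  simp only [src, mul_inv_rev, mul_assoc]

theorem src_mul_src (s t : S) : src (s * t) * src s = src (s * t) := by
  rw [src_mul_eq]
  simp only [src, mul_assoc]
  rw [← mul_assoc s⁻¹ s s⁻¹, inv_mul_inv]

/-- Here and below, `e * f = e` expresses `e ≤ f` for idempotents; the point is that `src (s * t) ≤
src s`. -/
theorem le_src_of_le_src_mul {e s t : S} (h : e * src (s * t) = e) : e * src s = e := by
  rw [← h, mul_assoc, src_mul_src]

theorem conj_idem {e s : S} (he : e * e = e) (h : e * src s = e) :
    (s⁻¹ * e * s) * (s⁻¹ * e * s) = s⁻¹ * e * s := by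
  calc (s⁻¹ * e * s) * (s⁻¹ * e * s) = s⁻¹ * (e * src s * e) * s := by
        simp only [src, mul_assoc]
    _ = s⁻¹ * e * s := by rw [h, he]

/-- For an idempotent `e`, `e ≤ (st)(st)⁻¹` iff `e ≤ ss⁻¹` and `s⁻¹es ≤ tt⁻¹`. -/
theorem le_src_mul_iff {e s t : S} (he : e * e = e) :
    e * src (s * t) = e ↔ e * src s = e ∧ (s⁻¹ * e * s) * src t = s⁻¹ * e * s := by
  constructor
  · intro h
    refine ⟨le_src_of_le_src_mul h, ?_⟩
    have hc := idem_comm (src_idem t) (inv_mul_idem s)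
    calc (s⁻¹ * e * s) * src t = s⁻¹ * e * (s * s⁻¹ * s) * src t := by rw [mul_inv_mul]
      _ = s⁻¹ * e * s * ((s⁻¹ * s) * src t) := by simp only [mul_assoc]
      _ = s⁻¹ * (e * src (s * t)) * s := by rw [← hc, src_mul_eq]; simp only [mul_assoc]
      _ = s⁻¹ * e * s := by rw [h]
  · rintro ⟨h1, h2⟩
    have h3 : e * s * (s⁻¹ * e * s) = e * s := by
      calc e * s * (s⁻¹ * e * s) = e * src s * e * s := by simp only [src, mul_assoc]
        _ = e * s := by rw [h1, he]
    calc e * src (s * t) = e * s * src t * s⁻¹ := by rw [src_mul_eq]; simp only [mul_assoc]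
      _ = e * s * ((s⁻¹ * e * s) * src t) * s⁻¹ := by rw [← mul_assoc (e * s), h3]
      _ = e * src s := by rw [h2, h3, src, mul_assoc]
      _ = e := h1

/-- Conjugations by `s` and by `s⁻¹` are mutually inverse between the idempotents below `s s⁻¹` and
those below `s⁻¹ s`. -/
theorem conj_conj_inv {e s : S} (he : e * e = e) (h : e * src s = e) :
    s⁻¹⁻¹ * (s⁻¹ * e * s) * s⁻¹ = e := by
  have hc := idem_comm he (src_idem s)
  calc s⁻¹⁻¹ * (s⁻¹ * e * s) * s⁻¹ = src s * e * src s := by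
        rw [inv_inv]; simp only [src, mul_assoc]
    _ = e := by rw [← hc, h, h]

theorem conj_le_src_inv (e s : S) : (s⁻¹ * e * s) * src s⁻¹ = s⁻¹ * e * s := by
  rw [src_inv]
  calc s⁻¹ * e * s * (s⁻¹ * s) = s⁻¹ * e * (s * s⁻¹ * s) := by simp only [mul_assoc]
    _ = _ := by rw [mul_inv_mul]

theorem sigma_iff {a b : S} : sigma S a b ↔ ∀ c : Con S, IsGroupCon c → c a b := Iff.rfl

theorem sigma_one_of_idem {e : S} (he : e * e = e) : sigma S e 1 := by
  rw [sigma_iff]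
  intro c hc
  simpa only [inv_eq_of_idem he, he] using (hc e).1

/-- If `e * a = e * b` for an idempotent `e`, then `a` and `b` are `σ`-related. -/
theorem sigma_of_idem_mul_eq {a b e : S} (he : e * e = e) (h : e * a = e * b) :
    sigma S a b := by
  have h1 := (sigma S).mul (sigma_one_of_idem he) ((sigma S).refl a)
  have h2 := (sigma S).mul (sigma_one_of_idem he) ((sigma S).refl b)
  rw [one_mul] at h1 h2
  rw [h] at h1
  exact (sigma S).trans ((sigma S).symm h1) h2

section Group

variable {G : Type v} [Group G] (π : S →* G)

theorem map_inv_group (s : S) : π s⁻¹ = (π s)⁻¹ := by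
  have h := congrArg π (mul_inv_mul s)
  simp only [map_mul] at h
  exact eq_inv_of_mul_eq_one_right (mul_eq_right.1 h)

theorem map_idem_group {e : S} (he : e * e = e) : π e = 1 := by
  have h := congrArg π he
  simpa using h

theorem eq_of_sigma {a b : S} (h : sigma S a b) : π a = π b := by
  refine sigma_iff.1 h (Con.ker π) fun s => ?_
  simp [Con.ker_rel, map_inv_group]

/-- If the preimage of `1` consists of idempotents, then `s` is determined by `s * s⁻¹` and its
image. -/
theorem eq_of_src_eq (hπ : ∀ s, π s = 1 → s * s = s) {s t : S} (h : src s = src t)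
    (hst : π s = π t) : s = t := by
  have key : ∀ {s t : S}, src s = src t → π s = π t → s * (s⁻¹ * t) = t := by
    intro s t h _
    rw [← mul_assoc, ← src, h, src_mul]
  -- Both quotients lie over `1`, so purity makes them commuting idempotents.
  have h1 : (s⁻¹ * t) * (s⁻¹ * t) = s⁻¹ * t := hπ _ (by simp [map_inv_group, hst])
  have h2 : (t⁻¹ * s) * (t⁻¹ * s) = t⁻¹ * s := hπ _ (by simp [map_inv_group, hst])
  have k1 := key h hst
  have k2 := key h.symm hst.symm
  calc s = t * (t⁻¹ * s) := k2.symm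
    _ = s * (s⁻¹ * t) * (t⁻¹ * s) := by rw [k1]
    _ = s * ((t⁻¹ * s) * (s⁻¹ * t)) := by rw [mul_assoc, idem_comm h1 h2]
    _ = t * (t⁻¹ * s) * (t⁻¹ * s) * (s⁻¹ * t) := by rw [k2, ← mul_assoc s]
    _ = t * (t⁻¹ * s) * (s⁻¹ * t) := by rw [mul_assoc t, h2]
    _ = t := by rw [k2, k1]

end Group

end Basic

end InverseMonoid

/-! ### Unions, translates and small subgraphs -/

namespace Cayley
namespace Sub

variable {X : Type u} {G : Type v} [Group G] {ι : X → G}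

instance : SemilatticeSup (Sub ι) where
  sup A B :=
    { verts := A.verts ∪ B.verts
      edges := A.edges ∪ B.edges
      source_mem := fun e he => he.imp (A.source_mem e) (B.source_mem e)
      target_mem := fun e he => he.imp (A.target_mem e) (B.target_mem e)
      inverse_mem := fun e he => he.imp (A.inverse_mem e) (B.inverse_mem e) }
  le_sup_left _ _ := ⟨Set.subset_union_left, Set.subset_union_left⟩
  le_sup_right _ _ := ⟨Set.subset_union_right, Set.subset_union_right⟩
  sup_le _ _ _ h k := ⟨Set.union_subset h.1 k.1, Set.union_subset h.2 k.2⟩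

theorem mem_verts_translate {g v : G} {A : Sub ι} :
    v ∈ (A.translate g).verts ↔ g⁻¹ * v ∈ A.verts := by
  constructor
  · rintro ⟨w, hw, rfl⟩
    simpa using hw
  · intro h
    exact ⟨_, h, by simp⟩

theorem mem_edges_translate {g v : G} {a : X × Bool} {A : Sub ι} :
    ((v, a) : Edge ι) ∈ (A.translate g).edges ↔ ((g⁻¹ * v, a) : Edge ι) ∈ A.edges := by
  constructor
  · rintro ⟨w, hw, h⟩
    obtain ⟨rfl, rfl⟩ := Prod.mk.inj h
    simpa using hw
  · intro h
    exact ⟨_, h, by simp [Edge.translate]⟩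

theorem ext' {A B : Sub ι} (hv : ∀ v, v ∈ A.verts ↔ v ∈ B.verts)
    (he : ∀ v a, ((v, a) : Edge ι) ∈ A.edges ↔ ((v, a) : Edge ι) ∈ B.edges) : A = B :=
  Sub.ext (Set.ext hv) (Set.ext fun ⟨v, a⟩ => he v a)

theorem translate_one (A : Sub ι) : A.translate 1 = A :=
  ext' (by simp [mem_verts_translate]) (by simp [mem_edges_translate])

theorem translate_comp (g h : G) (A : Sub ι) :
    (A.translate h).translate g = A.translate (g * h) :=
  ext' (by simp [mem_verts_translate, mul_assoc]) (by simp [mem_edges_translate, mul_assoc])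

theorem translate_sup (g : G) (A B : Sub ι) :
    (A ⊔ B).translate g = A.translate g ⊔ B.translate g :=
  Sub.ext (Set.image_union ..) (Set.image_union ..)

theorem translate_mono {A B : Sub ι} (h : A ≤ B) (g : G) : A.translate g ≤ B.translate g :=
  ⟨Set.image_mono h.1, Set.image_mono h.2⟩

theorem translate_le_iff {A B : Sub ι} {g : G} : A.translate g ≤ B ↔ A ≤ B.translate g⁻¹ := by
  constructor
  · intro h
    simpa [translate_comp, translate_one] using translate_mono h g⁻¹
  · intro h
    simpa [translate_comp, translate_one] using translate_mono h g

theorem translate_le_translate_iff {A B : Sub ι} {g : G} :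
    A.translate g ≤ B.translate g ↔ A ≤ B := by
  rw [translate_le_iff, translate_comp, inv_mul_cancel, translate_one]

theorem IsFinite.translate {A : Sub ι} (h : A.IsFinite) (g : G) : (A.translate g).IsFinite :=
  ⟨h.1.image _, h.2.image _⟩

theorem IsFinite.sup {A B : Sub ι} (hA : A.IsFinite) (hB : B.IsFinite) : (A ⊔ B).IsFinite :=
  ⟨hA.1.union hB.1, hA.2.union hB.2⟩

theorem inverse_inverse (e : Edge ι) : Edge.inverse (Edge.inverse e) = e := by
  obtain ⟨g, x, b⟩ := e
  cases b <;> simp [Edge.inverse, Edge.target, letterVal]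

theorem target_inverse (e : Edge ι) : Edge.target (Edge.inverse e) = Edge.source e := by
  obtain ⟨g, x, b⟩ := e
  cases b <;> simp [Edge.inverse, Edge.target, Edge.source, letterVal]

/-- The subgraph consisting of an edge, its inverse and its endpoints. -/
def edgeSub (e : Edge ι) : Sub ι where
  verts := {Edge.source e, Edge.target e}
  edges := {e, Edge.inverse e}
  source_mem := by
    rintro _ (rfl | rfl)
    · exact Or.inl rfl
    · exact Or.inr rfl
  target_mem := by
    rintro _ (rfl | rfl)
    · exact Or.inr rfl
    · exact Or.inl (target_inverse _)
  inverse_mem := by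
    rintro _ (rfl | rfl)
    · exact Or.inr rfl
    · exact Or.inl (inverse_inverse _)

theorem edgeSub_le_iff {e : Edge ι} {A : Sub ι} : edgeSub e ≤ A ↔ e ∈ A.edges := by
  constructor
  · intro h
    exact h.2 (Or.inl rfl)
  · intro h
    refine ⟨?_, ?_⟩
    · rintro _ (rfl | rfl)
      exacts [A.source_mem _ h, A.target_mem _ h]
    · rintro _ (rfl | rfl)
      exacts [h, A.inverse_mem _ h]

theorem translate_edgeSub (g v : G) (a : X × Bool) :
    (edgeSub (ι := ι) (v, a)).translate g = edgeSub (ι := ι) (g * v, a) := by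
  apply le_antisymm
  · rw [translate_le_iff, edgeSub_le_iff, mem_edges_translate, _root_.inv_inv]
    exact edgeSub_le_iff.1 le_rfl
  · rw [edgeSub_le_iff, mem_edges_translate, inv_mul_cancel_left]
    exact edgeSub_le_iff.1 le_rfl

theorem edgeSub_isFinite (e : Edge ι) : (edgeSub e).IsFinite :=
  ⟨(Set.finite_singleton _).insert _, (Set.finite_singleton _).insert _⟩

/-- The edgeless subgraph with the vertices `v` and `w`. -/
def pairSub (ι : X → G) (v w : G) : Sub ι where
  verts := {v, w}
  edges := ∅
  source_mem _ h := h.elim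
  target_mem _ h := h.elim
  inverse_mem _ h := h.elim

theorem pairSub_le_iff {v w : G} {A : Sub ι} :
    pairSub ι v w ≤ A ↔ v ∈ A.verts ∧ w ∈ A.verts := by
  constructor
  · intro h
    exact ⟨h.1 (Or.inl rfl), h.1 (Or.inr rfl)⟩
  · rintro ⟨hv, hw⟩
    refine ⟨?_, fun _ h => h.elim⟩
    rintro _ (rfl | rfl)
    exacts [hv, hw]

theorem translate_pairSub (g v w : G) :
    (pairSub ι v w).translate g = pairSub ι (g * v) (g * w) := by
  apply le_antisymm
  · rw [translate_le_iff, pairSub_le_iff, mem_verts_translate, mem_verts_translate,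
      _root_.inv_inv]
    exact pairSub_le_iff.1 le_rfl
  · rw [pairSub_le_iff, mem_verts_translate, mem_verts_translate, inv_mul_cancel_left,
      inv_mul_cancel_left]
    exact pairSub_le_iff.1 le_rfl

theorem pairSub_isFinite (v w : G) : (pairSub ι v w).IsFinite :=
  ⟨(Set.finite_singleton _).insert _, Set.finite_empty⟩

theorem Step.reverse {A : Sub ι} {g h : G} (hs : A.Step g h) : A.Step h g := by
  obtain ⟨e, he, rfl, rfl⟩ := hs
  exact ⟨_, A.inverse_mem e he, rfl, target_inverse e⟩

theorem Step.mono {A B : Sub ι} (hAB : A ≤ B) {g h : G} (hs : A.Step g h) : B.Step g h := by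
  obtain ⟨e, he, h1, h2⟩ := hs
  exact ⟨e, hAB.2 he, h1, h2⟩

end Sub
end Cayley

/-! ### Admissible properties and generation of pointed finite subgraphs -/

namespace Cayley

variable {X : Type u} {G : Type v} [Group G] {ι : X → G}

namespace Sub

/-- A relation between subgraphs and elements of `G` that contains the edgeless subgraphs on
`{1, g}` satisfying `Q` and the one-edge subgraphs, and is closed under products. -/
structure Multiplicative (Q : Sub ι → Prop) (R : Sub ι → G → Prop) : Prop where
  pair : ∀ g, Q (pairSub ι 1 g) → R (pairSub ι 1 g) g
  letter : ∀ a, R (edgeSub (ι := ι) (1, a)) (letterVal ι a)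
  mul : ∀ A g B h, R A g → R B h → R (A ⊔ B.translate g) (g * h)

/-- The properties of connectedness and of nonemptiness on which the constructions depend. -/
class Admissible (Q : Sub ι → Prop) : Prop where
  nonempty : ∀ A, Q A → A.verts.Nonempty
  translate : ∀ A g, Q A → Q (A.translate g)
  letter : ∀ e, Q (edgeSub e)
  vertex : Q (pairSub ι 1 1)
  glue : ∀ A C, Q A → A ≤ C →
    (∀ v ∈ C.verts, ∃ B ≤ C, Q B ∧ v ∈ B.verts ∧ ∃ w ∈ A.verts, w ∈ B.verts) → Q C
  path : ∀ R, Multiplicative Q R → ∀ A, Q A → ∀ v ∈ A.verts, ∀ w ∈ A.verts,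
    ∃ W, R W (v⁻¹ * w) ∧ W.translate v ≤ A

/-- A finite subgraph satisfying `Q` with vertices `1` and `g`. -/
structure Pointed (Q : Sub ι → Prop) (A : Sub ι) (g : G) : Prop where
  prop : Q A
  finite : A.IsFinite
  one_mem : 1 ∈ A.verts
  mem : g ∈ A.verts

theorem mem_pairSub_left (v w : G) : v ∈ (pairSub ι v w).verts := Or.inl rfl

theorem mem_pairSub_right (v w : G) : w ∈ (pairSub ι v w).verts := Or.inr rfl

theorem Pointed.pair {Q : Sub ι → Prop} {g : G} (h : Q (pairSub ι 1 g)) : Pointed Q (pairSub ι 1 g) g :=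
  ⟨h, pairSub_isFinite _ _, mem_pairSub_left _ _, mem_pairSub_right _ _⟩

section Admissible

variable {Q : Sub ι → Prop} [Admissible Q]

theorem Admissible.sup {A B : Sub ι} (hA : Q A) (hB : Q B) {v : G} (hv : v ∈ A.verts)
    (hv' : v ∈ B.verts) : Q (A ⊔ B) := by
  refine Admissible.glue A _ hA le_sup_left ?_
  rintro w (hw | hw)
  · exact ⟨A, le_sup_left, hA, hw, w, hw, hw⟩
  · exact ⟨B, le_sup_right, hB, hw, v, hv, hv'⟩

theorem Admissible.vertex' (v : G) : Q (pairSub ι v v) := by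
  have := Admissible.translate _ v (Admissible.vertex (Q := Q))
  rwa [translate_pairSub, mul_one] at this

theorem one_mem_letter (a : X × Bool) : 1 ∈ (edgeSub (ι := ι) (1, a)).verts := Or.inl rfl

theorem letterVal_mem_letter (a : X × Bool) :
    letterVal ι a ∈ (edgeSub (ι := ι) (1, a)).verts := Or.inr (one_mul _).symm

theorem Pointed.letter (a : X × Bool) :
    Pointed Q (edgeSub (ι := ι) (1, a)) (letterVal ι a) :=
  ⟨Admissible.letter _, edgeSub_isFinite _, one_mem_letter a, letterVal_mem_letter a⟩

theorem Pointed.mul {A B : Sub ι} {g h : G} (hA : Pointed Q A g) (hB : Pointed Q B h) :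
    Pointed Q (A ⊔ B.translate g) (g * h) :=
  ⟨Admissible.sup hA.prop (Admissible.translate _ _ hB.prop) hA.mem
      (mem_verts_translate.2 (by simpa using hB.one_mem)),
    hA.finite.sup (hB.finite.translate g), Or.inl hA.one_mem,
    Or.inr (mem_verts_translate.2 (by simpa using hB.mem))⟩

theorem Pointed.inv {A : Sub ι} {g : G} (hA : Pointed Q A g) :
    Pointed Q (A.translate g⁻¹) g⁻¹ :=
  ⟨Admissible.translate _ _ hA.prop, hA.finite.translate _,
    mem_verts_translate.2 (by simpa using hA.mem),
    mem_verts_translate.2 (by simpa using hA.one_mem)⟩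

theorem Pointed.translate {A : Sub ι} {v w : G} (hA : Q A) (hf : A.IsFinite) (hv : v ∈ A.verts)
    (hw : w ∈ A.verts) : Pointed Q (A.translate v⁻¹) (v⁻¹ * w) :=
  ⟨Admissible.translate _ _ hA, hf.translate _,
    mem_verts_translate.2 (by simpa using hv), mem_verts_translate.2 (by simpa using hw)⟩

theorem multiplicative_pointed : Multiplicative Q (Pointed Q) :=
  ⟨fun _ => Pointed.pair, Pointed.letter, fun _ _ _ _ => Pointed.mul⟩

/-- Being pointed is itself multiplicative, so the path axiom supplies a finite piece of `A` linking
`v` to `w`. -/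
theorem Admissible.exists_finite {A : Sub ι} (hA : Q A) {v w : G} (hv : v ∈ A.verts)
    (hw : w ∈ A.verts) : ∃ F ≤ A, Q F ∧ F.IsFinite ∧ v ∈ F.verts ∧ w ∈ F.verts := by
  obtain ⟨W, hW, hle⟩ := Admissible.path _ (multiplicative_pointed (Q := Q)) A hA v hv w hw
  exact ⟨_, hle, Admissible.translate _ _ hW.prop, hW.finite.translate _,
    mem_verts_translate.2 (by simpa using hW.one_mem), mem_verts_translate.2 hW.mem⟩

/-- The finite subgraphs satisfying `Q` with a marked vertex are generated by the edgeless
subgraphs on `{1, g}` satisfying `Q` and the one-edge subgraphs. -/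
theorem Multiplicative.induction {R : Sub ι → G → Prop} (hR : Multiplicative Q R) {A : Sub ι}
    {g : G} (hA : Pointed Q A g) : R A g := by
  -- Strengthening `R` by `Pointed` records that each piece contains its marked vertices.
  let R' : Sub ι → G → Prop := fun W g => R W g ∧ Pointed Q W g
  have hR' : Multiplicative Q R' :=
    ⟨fun g hg => ⟨hR.pair g hg, .pair hg⟩, fun a => ⟨hR.letter a, .letter a⟩,
      fun _ _ _ _ h k => ⟨hR.mul _ _ _ _ h.1 k.1, h.2.mul k.2⟩⟩
  have path := Admissible.path (Q := Q) R' hR' A hA.prop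
  -- A round trip from `1` through `v` has marked element `1`, so such pieces multiply by plain
  -- union, without translation.
  have loop : ∀ v ∈ A.verts, ∃ W ≤ A, R' W 1 ∧ v ∈ W.verts := by
    intro v hv
    obtain ⟨W, hW, hle⟩ := path 1 hA.one_mem v hv
    obtain ⟨W', hW', hle'⟩ := path v hv 1 hA.one_mem
    rw [inv_one, one_mul] at hW
    rw [translate_one] at hle
    refine ⟨W ⊔ W'.translate v, sup_le hle hle', ?_, Or.inl hW.2.mem⟩
    simpa using hR'.mul _ _ _ _ hW hW'
  have loop' : ∀ e ∈ A.edges, ∃ W ≤ A, R' W 1 ∧ e ∈ W.edges := by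
    rintro ⟨v, a⟩ he
    obtain ⟨W, hW, hle⟩ := path 1 hA.one_mem v (A.source_mem _ he)
    obtain ⟨W', hW', hle'⟩ := path (v * letterVal ι a) (A.target_mem _ he) 1 hA.one_mem
    rw [inv_one, one_mul] at hW
    rw [translate_one] at hle
    have key : (edgeSub (ι := ι) (1, a)).translate v = edgeSub (ι := ι) (v, a) := by
      rw [translate_edgeSub, mul_one]
    refine ⟨(W ⊔ (edgeSub (ι := ι) (1, a)).translate v) ⊔ W'.translate (v * letterVal ι a),
      sup_le (sup_le hle ?_) hle', ?_, Or.inl (Or.inr ?_)⟩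
    · rwa [key, edgeSub_le_iff]
    · simpa using hR'.mul _ _ _ _ (hR'.mul _ _ _ _ hW (hR'.letter a)) hW'
    · rw [key]
      exact edgeSub_le_iff.1 le_rfl
  have mul : ∀ {W W' : Sub ι} {h : G}, R' W 1 → R' W' h → R' (W ⊔ W') h := by
    intro W W' h h1 h2
    simpa [translate_one] using hR'.mul _ _ _ _ h1 h2
  have base : ∃ W ≤ A, R' W 1 := (loop 1 hA.one_mem).imp fun W h => ⟨h.1, h.2.1⟩
  have verts : ∃ W ≤ A, R' W 1 ∧ A.verts ⊆ W.verts := by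
    suffices ∀ D ⊆ A.verts, D.Finite → ∃ W ≤ A, R' W 1 ∧ D ⊆ W.verts from
      this _ subset_rfl hA.finite.1
    intro D hD hf
    induction D, hf using Set.Finite.induction_on with
    | empty => exact base.imp fun W h => ⟨h.1, h.2, Set.empty_subset _⟩
    | insert _ _ ih =>
      obtain ⟨hv, hD⟩ := Set.insert_subset_iff.1 hD
      obtain ⟨W, h1, h2, h3⟩ := ih hD
      obtain ⟨W', h1', h2', h3'⟩ := loop _ hv
      exact ⟨W' ⊔ W, sup_le h1' h1, mul h2' h2,
        Set.insert_subset (Or.inl h3') (h3.trans Set.subset_union_right)⟩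
  have edges : ∃ W ≤ A, R' W 1 ∧ A.edges ⊆ W.edges := by
    suffices ∀ D ⊆ A.edges, D.Finite → ∃ W ≤ A, R' W 1 ∧ D ⊆ W.edges from
      this _ subset_rfl hA.finite.2
    intro D hD hf
    induction D, hf using Set.Finite.induction_on with
    | empty => exact base.imp fun W h => ⟨h.1, h.2, Set.empty_subset _⟩
    | insert _ _ ih =>
      obtain ⟨hv, hD⟩ := Set.insert_subset_iff.1 hD
      obtain ⟨W, h1, h2, h3⟩ := ih hD
      obtain ⟨W', h1', h2', h3'⟩ := loop' _ hv
      exact ⟨W' ⊔ W, sup_le h1' h1, mul h2' h2,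
        Set.insert_subset (Or.inl h3') (h3.trans Set.subset_union_right)⟩
  obtain ⟨V, hVA, hV, hAV⟩ := verts
  obtain ⟨E, hEA, hE, hAE⟩ := edges
  obtain ⟨W, hW, hWA⟩ := path 1 hA.one_mem g hA.mem
  rw [inv_one, one_mul] at hW
  rw [translate_one] at hWA
  -- Loops covering all vertices, loops covering all edges, and a final piece from `1` to `g`
  -- together exhaust `A`.
  have : V ⊔ (E ⊔ W) = A := le_antisymm (sup_le hVA (sup_le hEA hWA))
    ⟨hAV.trans Set.subset_union_left,
      hAE.trans (Set.subset_union_left.trans Set.subset_union_right)⟩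
  rw [← this]
  exact (mul hV (mul hE hW)).1

end Admissible

/-! ### The two instances -/

theorem isConnected_edgeSub (e : Edge ι) : (edgeSub e).IsConnected := by
  refine ⟨⟨_, Or.inl rfl⟩, ?_⟩
  have h : (edgeSub e).Step (Edge.source e) (Edge.target e) := ⟨e, Or.inl rfl, rfl, rfl⟩
  rintro _ (rfl | rfl) _ (rfl | rfl)
  exacts [.refl, .single h, .single h.reverse, .refl]

theorem eq_of_isConnected_pairSub {v w : G} (h : (pairSub ι v w).IsConnected) : v = w := by
  rcases (h.2 v (Or.inl rfl) w (Or.inr rfl)).cases_head with h | ⟨_, ⟨_, he, _⟩, _⟩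
  · exact h
  · exact he.elim

theorem reflTransGen_step_symm {A : Sub ι} {g h : G}
    (hs : Relation.ReflTransGen A.Step g h) : Relation.ReflTransGen A.Step h g := by
  induction hs with
  | refl => exact .refl
  | tail _ hs ih => exact .head hs.reverse ih

/-- For `path`, a walk from `v` to `w` is read off as a product of one-edge graphs; the only
edgeless factor needed is the single vertex `1`. -/
instance : Admissible (IsConnected (ι := ι)) where
  nonempty _ h := h.1
  translate _ g h := h.translate g
  letter := isConnected_edgeSub
  vertex := by
    refine ⟨⟨1, Or.inl rfl⟩, ?_⟩
    rintro _ (rfl | rfl) _ (rfl | rfl) <;> exact .refl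
  glue A C hA hAC h := by
    refine ⟨hA.1.mono hAC.1, ?_⟩
    have key : ∀ v ∈ C.verts, ∃ w ∈ A.verts, Relation.ReflTransGen C.Step v w := by
      intro v hv
      obtain ⟨B, hBC, hB, hvB, w, hwA, hwB⟩ := h v hv
      exact ⟨w, hwA, Relation.ReflTransGen.mono (fun _ _ => Step.mono hBC) _ _ (hB.2 v hvB w hwB)⟩
    intro g hg h hh
    obtain ⟨g', hg', pg⟩ := key g hg
    obtain ⟨h', hh', ph⟩ := key h hh
    exact (pg.trans (Relation.ReflTransGen.mono (fun _ _ => Step.mono hAC) _ _ (hA.2 g' hg' h' hh'))).trans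
      (reflTransGen_step_symm ph)
  path R hR A hA v hv w hw := by
    have h := hA.2 v hv w hw
    clear hw
    induction h with
    | refl =>
      refine ⟨pairSub ι 1 1, ?_, ?_⟩
      · rw [inv_mul_cancel]
        apply hR.pair
        refine ⟨⟨1, Or.inl rfl⟩, ?_⟩
        rintro _ (rfl | rfl) _ (rfl | rfl) <;> exact .refl
      · rw [translate_pairSub, mul_one, pairSub_le_iff]
        exact ⟨hv, hv⟩
    | tail _ hs ih =>
      obtain ⟨W, hW, hle⟩ := ih
      obtain ⟨⟨g, a⟩, he, rfl, rfl⟩ := hs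
      refine ⟨W ⊔ (edgeSub (ι := ι) (1, a)).translate (v⁻¹ * g), ?_, ?_⟩
      · have := hR.mul _ _ _ _ hW (hR.letter a)
        rwa [mul_assoc] at this
      · rw [translate_sup, translate_comp, mul_inv_cancel_left, translate_edgeSub, mul_one]
        exact sup_le hle (edgeSub_le_iff.2 he)

/-- A subgraph is nonempty if it has a vertex. -/
def IsNonempty (A : Sub ι) : Prop := A.verts.Nonempty

/-- No walk is needed for `path`: the edgeless graph on the two vertices already serves. -/
instance : Admissible (IsNonempty (ι := ι)) where
  nonempty _ h := h
  translate _ g h := h.image _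
  letter _ := ⟨_, Or.inl rfl⟩
  vertex := ⟨1, Or.inl rfl⟩
  glue _ _ hA hAC _ := hA.mono hAC.1
  path R hR A hA v hv w hw := by
    refine ⟨pairSub ι 1 (v⁻¹ * w), hR.pair _ ⟨1, Or.inl rfl⟩, ?_⟩
    rw [translate_pairSub, mul_one, mul_inv_cancel_left, pairSub_le_iff]
    exact ⟨hv, hw⟩

/-- The whole Cayley graph. -/
def full (ι : X → G) : Sub ι where
  verts := Set.univ
  edges := Set.univ
  source_mem _ _ := trivial
  target_mem _ _ := trivial
  inverse_mem _ _ := trivial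

theorem isConnected_full (hι : Subgroup.closure (Set.range ι) = ⊤) :
    (full ι).IsConnected := by
  have step : ∀ g a, (full ι).Step g (g * letterVal ι a) := fun g a =>
    ⟨(g, a), trivial, rfl, rfl⟩
  have key : ∀ g, Relation.ReflTransGen (full ι).Step 1 g := by
    intro g
    have hg : g ∈ Subgroup.closure (Set.range ι) := hι ▸ Subgroup.mem_top g
    induction hg using Subgroup.closure_induction_right with
    | one => exact .refl
    | mul_right g _ _ hx ih =>
      obtain ⟨x, rfl⟩ := hx
      exact ih.tail (step g (x, true))
    | mul_inv_cancel g _ _ hx ih =>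
      obtain ⟨x, rfl⟩ := hx
      exact ih.tail (step g (x, false))
  exact ⟨⟨1, trivial⟩, fun g _ h _ => (reflTransGen_step_symm (key g)).trans (key h)⟩

end Sub

end Cayley

/-! ### The inverse monoid of a closure operator -/

namespace Cayley

variable {X : Type u} {G : Type v} [Group G] {ι : X → G}

/-- A `G`-invariant, finitary closure operator on the subgraphs satisfying `Q`, as a map on all
subgraphs whose values outside `Q` are irrelevant. -/
structure GClosure (Q : Sub ι → Prop) where
  cl : Sub ι → Sub ι
  prop : ∀ A, Q A → Q (cl A)
  le_cl : ∀ A, Q A → A ≤ cl A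
  mono : ∀ A B, Q A → Q B → A ≤ B → cl A ≤ cl B
  idem : ∀ A, Q A → cl (cl A) ≤ cl A
  inv : ∀ A g, Q A → cl (A.translate g) = (cl A).translate g
  fin_verts : ∀ A, Q A → ∀ v ∈ (cl A).verts,
    ∃ F ≤ A, Q F ∧ F.IsFinite ∧ v ∈ (cl F).verts
  fin_edges : ∀ A, Q A → ∀ e ∈ (cl A).edges,
    ∃ F ≤ A, Q F ∧ F.IsFinite ∧ e ∈ (cl F).edges

namespace GClosure

open Cayley.Sub

variable {Q : Sub ι → Prop} (c : GClosure Q)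

theorem cl_cl {A : Sub ι} (hA : Q A) : c.cl (c.cl A) = c.cl A :=
  le_antisymm (c.idem A hA) (c.le_cl _ (c.prop _ hA))

theorem cl_le {A B : Sub ι} (hA : Q A) (hB : Q B) (h : A ≤ c.cl B) : c.cl A ≤ c.cl B :=
  (c.mono _ _ hA (c.prop _ hB) h).trans (c.idem B hB)

/-- `c ≤ c'` on the subgraphs satisfying `Q`. -/
def LE (c c' : GClosure Q) : Prop := ∀ A, Q A → c.cl A ≤ c'.cl A

theorem LE.cl_cl {c c' : GClosure Q} (h : c.LE c') {A : Sub ι} (hA : Q A) :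
    c'.cl (c.cl A) = c'.cl A :=
  le_antisymm (c'.cl_le (c.prop _ hA) hA (h A hA))
    (c'.mono _ _ hA (c.prop _ hA) (c.le_cl _ hA))

/-- The monoid of pairs `(F^c, g)` with `F` a finite subgraph satisfying `Q` that contains the
vertices `1` and `g`. -/
def Mon (c : GClosure Q) : Type (max u v) :=
  {p : Sub ι × G // ∃ F, Pointed Q F p.2 ∧ p.1 = c.cl F}

variable {c}

/-- The element `(F^c, g)`. -/
def elt {F : Sub ι} {g : G} (h : Pointed Q F g) : c.Mon := ⟨(c.cl F, g), F, h, rfl⟩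

theorem exists_elt (a : c.Mon) : ∃ (F : Sub ι) (g : G) (h : Pointed Q F g), a = elt h := by
  obtain ⟨⟨K, g⟩, F, hF, hK⟩ := a
  obtain rfl : K = c.cl F := hK
  exact ⟨F, g, hF, rfl⟩

theorem elt_eq_elt {F F' : Sub ι} {g g' : G} {h : Pointed Q F g} {h' : Pointed Q F' g'} :
    (elt h : c.Mon) = elt h' ↔ c.cl F = c.cl F' ∧ g = g' := by
  constructor
  · intro he
    exact Prod.ext_iff.1 (congrArg Subtype.val he)
  · rintro ⟨h1, h2⟩
    exact Subtype.ext (Prod.ext h1 h2)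

theorem elt_congr {A B : Sub ι} {g h : G} {hA : Pointed Q A g} {hB : Pointed Q B h}
    (h1 : A = B) (h2 : g = h) : (elt hA : c.Mon) = elt hB := by
  subst h1 h2
  rfl

variable (c) [Admissible Q]

/-- The common vertex keeps both unions inside `Q`, where the closure axioms apply. -/
theorem cl_cl_sup {A B : Sub ι} (hA : Q A) (hB : Q B) {v : G} (hv : v ∈ A.verts)
    (hv' : v ∈ B.verts) : c.cl (c.cl A ⊔ B) = c.cl (A ⊔ B) := by
  have hAB := Admissible.sup hA hB hv hv'
  have hcA := Admissible.sup (c.prop _ hA) hB ((c.le_cl A hA).1 hv) hv'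
  apply le_antisymm
  · exact c.cl_le hcA hAB (sup_le (c.mono _ _ hA hAB le_sup_left)
      (le_sup_right.trans (c.le_cl _ hAB)))
  · exact c.mono _ _ hAB hcA (sup_le_sup_right (c.le_cl A hA) B)

theorem cl_sup_cl {A B : Sub ι} (hA : Q A) (hB : Q B) {v : G} (hv : v ∈ A.verts)
    (hv' : v ∈ B.verts) : c.cl (A ⊔ c.cl B) = c.cl (A ⊔ B) := by
  rw [sup_comm, c.cl_cl_sup hB hA hv' hv, sup_comm]

variable {c}

/-- The product of closures depends only on the product of finite representatives, so identities in
the monoid reduce to identities between unions of translates. -/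
theorem cl_mul {A B : Sub ι} {g h : G} (hA : Pointed Q A g) (hB : Pointed Q B h) :
    c.cl (c.cl A ⊔ (c.cl B).translate g) = c.cl (A ⊔ B.translate g) := by
  have hB' := Admissible.translate _ g hB.prop
  have h1 : g ∈ (B.translate g).verts := mem_verts_translate.2 (by simpa using hB.one_mem)
  rw [← c.inv _ _ hB.prop, c.cl_cl_sup hA.prop (c.prop _ hB') hA.mem ((c.le_cl _ hB').1 h1),
    c.cl_sup_cl hA.prop hB' hA.mem h1]

instance : Mul c.Mon where
  mul a b := ⟨(c.cl (a.1.1 ⊔ b.1.1.translate a.1.2), a.1.2 * b.1.2), by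
    obtain ⟨A, g, hA, rfl⟩ := exists_elt a
    obtain ⟨B, h, hB, rfl⟩ := exists_elt b
    exact ⟨_, hA.mul hB, cl_mul hA hB⟩⟩

instance : One c.Mon where
  one := elt (Pointed.pair Admissible.vertex)

instance : Inv c.Mon where
  inv a := ⟨(a.1.1.translate a.1.2⁻¹, a.1.2⁻¹), by
    obtain ⟨A, g, hA, rfl⟩ := exists_elt a
    exact ⟨_, hA.inv, (c.inv _ _ hA.prop).symm⟩⟩

theorem elt_mul_elt {A B : Sub ι} {g h : G} (hA : Pointed Q A g) (hB : Pointed Q B h) :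
    (elt hA * elt hB : c.Mon) = elt (hA.mul hB) :=
  Subtype.ext (Prod.ext (cl_mul hA hB) rfl)

theorem elt_inv {A : Sub ι} {g : G} (hA : Pointed Q A g) :
    ((elt hA)⁻¹ : c.Mon) = elt hA.inv :=
  Subtype.ext (Prod.ext (c.inv _ _ hA.prop).symm rfl)

theorem one_def : (1 : c.Mon) = elt (Pointed.pair Admissible.vertex) := rfl

theorem vertex_sup {A : Sub ι} {v : G} (hv : v ∈ A.verts) : pairSub ι v v ⊔ A = A :=
  sup_eq_right.2 (pairSub_le_iff.2 ⟨hv, hv⟩)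

theorem sup_vertex {A : Sub ι} {v : G} (hv : v ∈ A.verts) : A ⊔ pairSub ι v v = A :=
  sup_eq_left.2 (pairSub_le_iff.2 ⟨hv, hv⟩)

instance : Monoid c.Mon where
  mul_assoc a b d := by
    obtain ⟨A, g, hA, rfl⟩ := exists_elt a
    obtain ⟨B, h, hB, rfl⟩ := exists_elt b
    obtain ⟨D, k, hD, rfl⟩ := exists_elt d
    simp only [elt_mul_elt]
    exact elt_congr (by rw [translate_sup, translate_comp, sup_assoc]) (mul_assoc _ _ _)
  one_mul a := by
    obtain ⟨A, g, hA, rfl⟩ := exists_elt a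
    rw [one_def, elt_mul_elt]
    exact elt_congr (by rw [translate_one, vertex_sup hA.one_mem]) (one_mul _)
  mul_one a := by
    obtain ⟨A, g, hA, rfl⟩ := exists_elt a
    rw [one_def, elt_mul_elt]
    exact elt_congr (by rw [translate_pairSub, mul_one, sup_vertex hA.mem]) (mul_one _)

instance : InverseMonoid c.Mon where
  mul_inv_mul a := by
    obtain ⟨A, g, hA, rfl⟩ := exists_elt a
    simp only [elt_mul_elt, elt_inv]
    exact elt_congr (by simp [translate_comp, translate_one]) (by simp)
  inv_mul_inv a := by
    obtain ⟨A, g, hA, rfl⟩ := exists_elt a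
    simp only [elt_mul_elt, elt_inv]
    exact elt_congr (by simp [translate_comp]) (by simp)
  inv_unique a b h1 h2 := by
    obtain ⟨A, g, hA, rfl⟩ := exists_elt a
    obtain ⟨B, h, hB, rfl⟩ := exists_elt b
    simp only [elt_mul_elt, elt_inv, elt_eq_elt] at h1 h2 ⊢
    have hh : h = g⁻¹ := eq_inv_of_mul_eq_one_right (mul_eq_right.1 h1.2)
    subst hh
    -- In `a b a = a` the translate of `B` by `g` is one of the joined pieces, hence lies in `A^c`;
    -- `b a b = b` gives the reverse inclusion.
    refine ⟨le_antisymm ?_ ?_, rfl⟩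
    · refine c.cl_le hB.prop hA.inv.prop ?_
      rw [c.inv _ _ hA.prop, ← translate_le_iff, ← h1.1]
      exact le_trans (le_sup_right.trans le_sup_left) (c.le_cl _ ((hA.mul hB).mul hA).prop)
    · refine c.cl_le hA.inv.prop hB.prop ?_
      rw [← h2.1]
      exact le_trans (le_sup_right.trans le_sup_left) (c.le_cl _ ((hB.mul hA).mul hB).prop)

/-- The projection `(F^c, g) ↦ g`. -/
def proj (c : GClosure Q) : c.Mon →* G where
  toFun a := a.1.2
  map_one' := rfl
  map_mul' _ _ := rfl

theorem proj_elt {A : Sub ι} {g : G} (hA : Pointed Q A g) : c.proj (elt hA) = g := rfl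

theorem idem_of_proj_eq_one (a : c.Mon) (h : c.proj a = 1) : a * a = a := by
  obtain ⟨A, g, hA, rfl⟩ := exists_elt a
  rw [elt_mul_elt]
  obtain rfl : g = 1 := h
  exact elt_congr (by rw [translate_one, sup_idem]) (one_mul _)

/-- Multiplying two elements over the same `g` by the product of their domains replaces both
subgraphs by `A ∪ B`. -/
theorem proj_eq_iff (a b : c.Mon) :
    c.proj a = c.proj b ↔ InverseMonoid.sigma c.Mon a b := by
  refine ⟨fun h => ?_, InverseMonoid.eq_of_sigma _⟩
  have ha : c.proj (a * b⁻¹) = 1 := by simp [InverseMonoid.map_inv_group, h]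
  refine InverseMonoid.sigma_of_idem_mul_eq (e := InverseMonoid.src a * InverseMonoid.src b)
    (InverseMonoid.idem_mul_idem (InverseMonoid.src_idem a) (InverseMonoid.src_idem b)) ?_
  obtain ⟨A, g, hA, rfl⟩ := exists_elt a
  obtain ⟨B, k, hB, rfl⟩ := exists_elt b
  obtain rfl : g = k := h
  simp only [InverseMonoid.src, elt_mul_elt, elt_inv]
  refine elt_congr ?_ rfl
  simp only [mul_inv_cancel, translate_comp, translate_one, sup_idem, one_mul]
  rw [sup_right_comm, sup_idem, sup_assoc, sup_idem]

theorem isEUnitary : InverseMonoid.IsEUnitary c.Mon := by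
  intro s
  rw [← proj_eq_iff, map_one]
  exact ⟨idem_of_proj_eq_one s, InverseMonoid.map_idem_group c.proj⟩

/-- The generators of `c.Mon`. -/
def gen (c : GClosure Q) (x : X) : c.Mon := elt (Pointed.letter (x, true))

/-- A one-edge graph also contains the inverse edge, so the graph of the letter `x⁻¹` is the graph
of `x` translated to start at the other endpoint. -/
theorem elt_letter_false (x : X) :
    (elt (Pointed.letter (x, false)) : c.Mon) = (c.gen x)⁻¹ := by
  rw [gen, elt_inv]
  refine elt_congr ?_ rfl
  rw [translate_edgeSub]
  have h : Edge.inverse (ι := ι) (1, (x, false)) =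
      (((letterVal ι (x, true))⁻¹ * 1, (x, true)) : Edge ι) := by
    simp [Edge.inverse, Edge.target, letterVal]
  rw [← h]
  apply le_antisymm <;> rw [edgeSub_le_iff]
  · exact Or.inr (inverse_inverse _).symm
  · exact Or.inr rfl

theorem proj_surjective (h : ∀ g, ∃ F, Pointed Q F g) : Function.Surjective c.proj := by
  intro g
  obtain ⟨F, hF⟩ := h g
  exact ⟨elt hF, rfl⟩

/-- A subset closed under the operations and containing the generators and the maximal elements
present is everything. -/
theorem mem_of_closed (T : Set c.Mon) (hgen : ∀ x, c.gen x ∈ T)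
    (hpair : ∀ g, ∀ h : Q (pairSub ι 1 g), elt (Pointed.pair h) ∈ T)
    (hmul : ∀ a ∈ T, ∀ b ∈ T, a * b ∈ T) (hinv : ∀ a ∈ T, a⁻¹ ∈ T) (a : c.Mon) : a ∈ T := by
  obtain ⟨A, g, hA, rfl⟩ := exists_elt a
  have hR : Multiplicative Q fun A g => ∃ h : Pointed Q A g, elt h ∈ T :=
    { pair := fun g h => ⟨_, hpair g h⟩
      letter := by
        rintro ⟨x, b⟩
        refine ⟨Pointed.letter _, ?_⟩
        cases b
        · rw [elt_letter_false]
          exact hinv _ (hgen x)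
        · exact hgen x
      mul := by
        rintro A g B h ⟨hA, hA'⟩ ⟨hB, hB'⟩
        exact ⟨hA.mul hB, elt_mul_elt (c := c) hA hB ▸ hmul _ hA' _ hB'⟩ }
  exact (hR.induction hA).2

/-! ### Morphisms -/

/-- The morphism `(F^c, g) ↦ (F^c', g)` for `c ≤ c'`. -/
def map {c c' : GClosure Q} (h : c.LE c') : c.Mon →* c'.Mon where
  toFun a := ⟨(c'.cl a.1.1, a.1.2), by
    obtain ⟨A, g, hA, rfl⟩ := exists_elt a
    exact ⟨A, hA, h.cl_cl hA.prop⟩⟩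
  map_one' := Subtype.ext (Prod.ext (h.cl_cl Admissible.vertex) rfl)
  map_mul' a b := by
    obtain ⟨A, g, hA, rfl⟩ := exists_elt a
    obtain ⟨B, k, hB, rfl⟩ := exists_elt b
    rw [elt_mul_elt]
    refine Subtype.ext (Prod.ext ?_ rfl)
    refine (h.cl_cl (hA.mul hB).prop).trans ?_
    change _ = c'.cl (c'.cl (c.cl A) ⊔ (c'.cl (c.cl B)).translate g)
    rw [h.cl_cl hA.prop, h.cl_cl hB.prop, cl_mul hA hB]

theorem map_elt {c c' : GClosure Q} (h : c.LE c') {A : Sub ι} {g : G} (hA : Pointed Q A g) :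
    map h (elt hA) = elt hA :=
  Subtype.ext (Prod.ext (h.cl_cl hA.prop) rfl)

theorem map_inv {c c' : GClosure Q} (h : c.LE c') (a : c.Mon) : map h a⁻¹ = (map h a)⁻¹ := by
  obtain ⟨A, g, hA, rfl⟩ := exists_elt a
  rw [elt_inv, map_elt, map_elt, elt_inv]

/-- A morphism preserving the generators and the maximal elements present exists only if
`c ≤ c'`. -/
theorem le_of_hom {c c' : GClosure Q} (φ : c.Mon →* c'.Mon) (hinv : ∀ a, φ a⁻¹ = (φ a)⁻¹)
    (hgen : ∀ x, φ (c.gen x) = c'.gen x)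
    (hpair : ∀ g, ∀ h : Q (pairSub ι 1 g), φ (elt (Pointed.pair h)) = elt (Pointed.pair h)) :
    c.LE c' := by
  have hR : Multiplicative Q fun A g => ∃ h : Pointed Q A g, φ (elt h) = elt h :=
    { pair := fun g h => ⟨_, hpair g h⟩
      letter := by
        rintro ⟨x, b⟩
        refine ⟨Pointed.letter _, ?_⟩
        cases b
        · rw [elt_letter_false, elt_letter_false, hinv, hgen]
        · exact hgen x
      mul := by
        rintro A g B h ⟨hA, hA'⟩ ⟨hB, hB'⟩
        exact ⟨hA.mul hB, by
          rw [← elt_mul_elt hA hB, map_mul, hA', hB', elt_mul_elt]⟩ }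
  have key : ∀ {A : Sub ι} {g : G} (hA : Pointed Q A g), φ (elt hA) = elt hA := fun hA =>
    (hR.induction hA).2
  -- Based at a common vertex `v`, the inclusion `H ≤ c.cl F` is the equality of the elements of `F
  -- ⊔ H` and `F` in `c.Mon`, which `φ` transports to `c'.Mon`.
  have finite : ∀ F H : Sub ι, Q F → F.IsFinite → Q H → H.IsFinite →
      (∃ v ∈ F.verts, v ∈ H.verts) → H ≤ c.cl F → H ≤ c'.cl F := by
    rintro F H hF hFf hH hHf ⟨v, hvF, hvH⟩ hHF
    have hFv := Pointed.translate hF hFf hvF hvF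
    have hFHv := Pointed.translate (Admissible.sup hF hH hvF hvH) (hFf.sup hHf) (Or.inl hvF)
      (Or.inl hvF)
    have h1 : (elt hFHv : c.Mon) = elt hFv := by
      rw [elt_eq_elt]
      refine ⟨?_, rfl⟩
      rw [c.inv _ _ (Admissible.sup hF hH hvF hvH), c.inv _ _ hF]
      congr 1
      exact le_antisymm (c.cl_le (Admissible.sup hF hH hvF hvH) hF (sup_le (c.le_cl _ hF) hHF))
        (c.mono _ _ hF (Admissible.sup hF hH hvF hvH) le_sup_left)
    have h2 := congrArg φ h1
    rw [key, key, elt_eq_elt, c'.inv _ _ (Admissible.sup hF hH hvF hvH), c'.inv _ _ hF] at h2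
    rw [← translate_le_translate_iff (g := v⁻¹), ← h2.1, translate_le_translate_iff]
    exact le_sup_right.trans (c'.le_cl _ (Admissible.sup hF hH hvF hvH))
  intro A hA
  constructor
  · intro v hv
    -- A point of `A^c` lies in some `F^c` with `F` finite; a finite `H ⊆ F^c` satisfying `Q` links
    -- it to `F`, so the finite case applies.
    obtain ⟨F, hFA, hF, hFf, hvF⟩ := c.fin_verts A hA v hv
    obtain ⟨w, hw⟩ := Admissible.nonempty F hF
    obtain ⟨H, hHF, hH, hHf, hvH, hwH⟩ :=
      Admissible.exists_finite (c.prop F hF) hvF ((c.le_cl F hF).1 hw)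
    exact (c'.mono _ _ hF hA hFA).1 ((finite F H hF hFf hH hHf ⟨w, hw, hwH⟩ hHF).1 hvH)
  · intro e he
    obtain ⟨F, hFA, hF, hFf, heF⟩ := c.fin_edges A hA e he
    obtain ⟨w, hw⟩ := Admissible.nonempty F hF
    have hvF := (c.cl F).source_mem e heF
    obtain ⟨H, hHF, hH, hHf, hvH, hwH⟩ :=
      Admissible.exists_finite (c.prop F hF) hvF ((c.le_cl F hF).1 hw)
    exact (c'.mono _ _ hF hA hFA).2 ((finite F _ hF hFf
      (Admissible.sup hH (Admissible.letter e) hvH (Or.inl rfl))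
      (hHf.sup (edgeSub_isFinite e)) ⟨w, hw, Or.inl hwH⟩
      (sup_le hHF (edgeSub_le_iff.2 heF))).2 (Or.inr (Or.inl rfl)))

end GClosure

end Cayley

/-! ### Schützenberger graphs and covering idempotents -/

namespace Cayley

variable {X : Type u} {G : Type v} [Group G] {ι : X → G}

open Cayley.Sub InverseMonoid

universe w

/-- The value of a letter of `X ∪ X⁻¹` in an inverse monoid. -/
def letterIn {X : Type u} {S : Type w} [InverseMonoid S] (gen : X → S) (a : X × Bool) : S :=
  if a.2 then gen a.1 else (gen a.1)⁻¹

/-- A homomorphism from an inverse monoid to `G` that respects the generators and is idempotent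
pure. -/
structure IsPure (ι : X → G) {S : Type w} [InverseMonoid S] (gen : X → S) (π : S →* G) :
    Prop where
  proj_gen : ∀ x, π (gen x) = ι x
  pure : ∀ s, π s = 1 → s * s = s

variable {S : Type w} [InverseMonoid S] {gen : X → S} {π : S →* G}

theorem letterIn_not (x : X) (b : Bool) : letterIn gen (x, !b) = (letterIn gen (x, b))⁻¹ := by
  cases b <;> simp [letterIn, InverseMonoid.inv_inv]

namespace IsPure

variable (h : IsPure ι gen π)

include h in
theorem proj_letter (a : X × Bool) : π (letterIn gen a) = letterVal ι a := by
  obtain ⟨x, b⟩ := a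
  cases b <;> simp [letterIn, letterVal, map_inv_group, h.proj_gen]

/-- The Schützenberger graph of the idempotent `e`, as a subgraph of the Cayley graph of `G`. -/
def graph (h : IsPure ι gen π) (e : S) : Sub ι where
  verts := {g | ∃ t, π t = g ∧ e * src t = e}
  edges := {x | ∃ t, π t = x.1 ∧ e * src (t * letterIn gen x.2) = e}
  source_mem := by
    rintro x ⟨t, ht, he⟩
    exact ⟨t, ht, le_src_of_le_src_mul he⟩
  target_mem := by
    rintro x ⟨t, ht, he⟩
    exact ⟨_, by rw [map_mul, ht, h.proj_letter]; rfl, he⟩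
  inverse_mem := by
    rintro ⟨g, x, b⟩ ⟨t, ht, he⟩
    refine ⟨t * letterIn gen (x, b), by rw [map_mul, ht, h.proj_letter]; rfl, ?_⟩
    have : src (t * letterIn gen (x, b) * letterIn gen (x, !b)) =
        src (t * letterIn gen (x, b)) := by
      rw [letterIn_not, mul_assoc, ← src, src_mul_eq, src_of_idem (src_idem _), src_mul_eq]
    change e * src (t * letterIn gen (x, b) * letterIn gen (x, !b)) = e
    rw [this]
    exact he

theorem mem_verts_graph {e : S} {g : G} :
    g ∈ (h.graph e).verts ↔ ∃ t, π t = g ∧ e * src t = e := Iff.rfl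

theorem mem_edges_graph {e : S} {g : G} {a : X × Bool} :
    ((g, a) : Edge ι) ∈ (h.graph e).edges ↔
      ∃ t, π t = g ∧ e * src (t * letterIn gen a) = e := Iff.rfl

theorem one_mem_graph (e : S) : 1 ∈ (h.graph e).verts :=
  ⟨1, map_one π, by rw [src_one, mul_one]⟩

theorem graph_anti {e f : S} (hef : e * f = e) : h.graph f ≤ h.graph e := by
  have key : ∀ x : S, f * x = f → e * x = e := by
    intro x hx
    rw [← hef, mul_assoc, hx]
  exact ⟨fun g ⟨t, ht, hf⟩ => ⟨t, ht, key _ hf⟩, fun g ⟨t, ht, hf⟩ => ⟨t, ht, key _ hf⟩⟩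

/-- The witnesses correspond under `t ↦ s⁻¹ t`. Taking `r = 1` treats vertices, taking `r` a letter
treats edges. -/
theorem exists_translate_iff {e s : S} (he : e * e = e) (hs : e * src s = e) (g : G) (r : S) :
    (∃ t, π t = g ∧ e * src (t * r) = e) ↔
      ∃ t, π t = (π s)⁻¹ * g ∧ (s⁻¹ * e * s) * src (t * r) = s⁻¹ * e * s := by
  constructor
  · rintro ⟨t, rfl, ht⟩
    refine ⟨s⁻¹ * t, by rw [map_mul, map_inv_group], ?_⟩
    rw [mul_assoc s⁻¹ t r, le_src_mul_iff (conj_idem he hs), conj_conj_inv he hs]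
    exact ⟨conj_le_src_inv e s, ht⟩
  · rintro ⟨t, ht, hr⟩
    refine ⟨s * t, by rw [map_mul, ht, mul_inv_cancel_left], ?_⟩
    rw [mul_assoc, le_src_mul_iff he]
    exact ⟨hs, hr⟩

/-- Passing from `e` to `s⁻¹ e s` only moves the base point of the graph to the vertex `π s`. -/
theorem translate_graph {e s : S} (he : e * e = e) (hs : e * src s = e) :
    (h.graph (s⁻¹ * e * s)).translate (π s) = h.graph e := by
  apply ext'
  · intro g
    rw [mem_verts_translate, mem_verts_graph, mem_verts_graph]
    simpa using (exists_translate_iff he hs g 1).symm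
  · intro g a
    rw [mem_edges_translate, mem_edges_graph, mem_edges_graph]
    exact (exists_translate_iff he hs g _).symm

/-- The idempotent `f` is the largest one whose Schützenberger graph contains `F`. -/
structure Covers (h : IsPure ι gen π) (F : Sub ι) (f : S) : Prop where
  idem : f * f = f
  le_iff : ∀ e : S, e * e = e → (F ≤ h.graph e ↔ e * f = e)

variable {h}

theorem Covers.le {F : Sub ι} {f : S} (hF : h.Covers F f) : F ≤ h.graph f :=
  (hF.le_iff f hF.idem).2 hF.idem

theorem Covers.letter (a : X × Bool) :
    h.Covers (edgeSub (ι := ι) (1, a)) (src (letterIn gen a)) := by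
  refine ⟨src_idem _, fun e he => ?_⟩
  rw [edgeSub_le_iff, mem_edges_graph]
  constructor
  · rintro ⟨t, ht, hta⟩
    -- Since `t` lies over `1` it is idempotent, whence `e ≤ src (t a) = t · src a ≤ src a`.
    have hi := h.pure t ht
    rw [src_mul_eq, inv_eq_of_idem hi] at hta
    rw [← hta]
    have hc := idem_comm hi (src_idem (letterIn gen a))
    rw [hc, mul_assoc (src _), hi, mul_assoc, mul_assoc, ← mul_assoc (src _) t, ← hc,
      mul_assoc t, src_idem]
  · intro ha
    exact ⟨1, map_one π, by rwa [one_mul]⟩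

theorem Covers.pair {g : G} {m : S} (hm : π m = g)
    (hmax : ∀ t, π t = g → src t * src m = src t) : h.Covers (pairSub ι 1 g) (src m) := by
  refine ⟨src_idem _, fun e he => ?_⟩
  rw [pairSub_le_iff, mem_verts_graph]
  constructor
  · rintro ⟨_, t, ht, hte⟩
    rw [← hte, mul_assoc, hmax t ht]
  · intro hem
    exact ⟨h.one_mem_graph e, m, hm, hem⟩

/-- By `le_src_mul_iff`, `e ≤ src (s t)` splits into `e ≤ src s` and `s⁻¹ e s ≤ src t`; by
`translate_graph` the latter says that the translate of `B` lies in the graph of `e`. -/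
theorem Covers.mul {A B : Sub ι} {s t : S} (hA : h.Covers A (src s)) (hB : h.Covers B (src t)) :
    h.Covers (A ⊔ B.translate (π s)) (src (s * t)) := by
  refine ⟨src_idem _, fun e he => ?_⟩
  rw [sup_le_iff, hA.le_iff e he, le_src_mul_iff he]
  refine and_congr_right fun hs => ?_
  rw [← h.translate_graph he hs, translate_le_translate_iff, hB.le_iff _ (conj_idem he hs)]

theorem Covers.inv {A : Sub ι} {s : S} (hA : h.Covers A (src s)) (h1 : 1 ∈ A.verts) : h.Covers (A.translate (π s)⁻¹) (src s⁻¹) := by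
  refine ⟨src_idem _, fun e he => ?_⟩
  constructor
  · intro hle
    -- The vertex `1` of `A` yields `t` over `(π s)⁻¹` with `e ≤ src t`. Then `e ≤ src (t s)`, and
    -- `t s` is an idempotent below `s⁻¹ s`.
    have hmem : (π s)⁻¹ ∈ (h.graph e).verts := by
      apply hle.1
      rw [mem_verts_translate]
      simpa using h1
    obtain ⟨t, ht, hte⟩ := hmem
    rw [← h.translate_graph he hte, ht, translate_le_translate_iff,
      hA.le_iff _ (conj_idem he hte)] at hle
    have h3 := (le_src_mul_iff he).2 ⟨hte, hle⟩
    have hts : (t * s) * (t * s) = t * s := h.pure _ (by rw [map_mul, ht, inv_mul_cancel])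
    rw [src_of_idem hts] at h3
    rw [src_inv, ← h3]
    calc e * (t * s) * (s⁻¹ * s) = e * (t * (s * s⁻¹ * s)) := by simp only [mul_assoc]
      _ = e * (t * s) := by rw [mul_inv_mul]
  · intro hes
    have h3 := h.translate_graph he hes
    rw [map_inv_group] at h3
    rw [← h3, translate_le_translate_iff, hA.le_iff _ (conj_idem he hes)]
    simpa only [InverseMonoid.inv_inv] using conj_le_src_inv e s⁻¹

/-- A translate of a Schützenberger graph that contains `F` contains the smallest such translate
based at a vertex of `F`. -/
theorem Covers.translate_graph_le {F : Sub ι} {h₀ h₁ : G} {e f : S} (he : e * e = e)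
    (hF : F ≤ (h.graph e).translate h₀) (h₁F : h₁ ∈ F.verts)
    (hc : h.Covers (F.translate h₁⁻¹) f) :
    (h.graph f).translate h₁ ≤ (h.graph e).translate h₀ := by
  obtain ⟨s, hs, hse⟩ := mem_verts_translate.1 (hF.1 h₁F)
  have h3 : (h.graph e).translate h₀ = (h.graph (s⁻¹ * e * s)).translate h₁ := by
    rw [← h.translate_graph he hse, translate_comp, hs, mul_inv_cancel_left]
  rw [h3] at hF ⊢
  apply translate_mono
  apply graph_anti
  rw [← hc.le_iff _ (conj_idem he hse), translate_le_iff, _root_.inv_inv]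
  exact hF

end IsPure

/-- An inverse monoid with an idempotent pure homomorphism to `G` whose elements are described by
the finite subgraphs satisfying `Q`. -/
structure IsModel (Q : Sub ι → Prop) {S : Type w} [InverseMonoid S] (gen : X → S)
    (π : S →* G) : Prop extends IsPure ι gen π where
  pair : ∀ g, Q (pairSub ι 1 g) → ∃ m, π m = g ∧ ∀ t, π t = g → src t * src m = src t
  cover : ∀ s, ∃ F, Pointed Q F (π s) ∧ toIsPure.Covers F (src s)

/-! ### The closure operator of an inverse monoid -/

namespace IsModel

variable {Q : Sub ι → Prop} (h : IsModel Q gen π)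

/-- The translate `h₀ • graph f` is the smallest one containing some finite subgraph of `A`. -/
def IsLocal (A : Sub ι) (h₀ : G) (f : S) : Prop :=
  ∃ F ≤ A, Q F ∧ F.IsFinite ∧ h₀ ∈ F.verts ∧ h.toIsPure.Covers (F.translate h₀⁻¹) f

/-- The closure operator belonging to an inverse monoid. -/
def closure (A : Sub ι) : Sub ι where
  verts := {v | ∃ h₀ f, h.IsLocal A h₀ f ∧ v ∈ ((h.graph f).translate h₀).verts}
  edges := {e | ∃ h₀ f, h.IsLocal A h₀ f ∧ e ∈ ((h.graph f).translate h₀).edges}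
  source_mem := by
    rintro e ⟨h₀, f, hf, he⟩
    exact ⟨h₀, f, hf, Sub.source_mem _ e he⟩
  target_mem := by
    rintro e ⟨h₀, f, hf, he⟩
    exact ⟨h₀, f, hf, Sub.target_mem _ e he⟩
  inverse_mem := by
    rintro e ⟨h₀, f, hf, he⟩
    exact ⟨h₀, f, hf, Sub.inverse_mem _ e he⟩

variable {h}

theorem IsLocal.le_closure {A : Sub ι} {h₀ : G} {f : S} (hf : h.IsLocal A h₀ f) :
    (h.graph f).translate h₀ ≤ h.closure A :=
  ⟨fun _ hv => ⟨h₀, f, hf, hv⟩, fun _ he => ⟨h₀, f, hf, he⟩⟩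

theorem closure_le {A C : Sub ι}
    (hC : ∀ h₀ f, h.IsLocal A h₀ f → (h.graph f).translate h₀ ≤ C) : h.closure A ≤ C :=
  ⟨fun _ ⟨h₀, f, hf, hv⟩ => (hC h₀ f hf).1 hv, fun _ ⟨h₀, f, hf, hv⟩ => (hC h₀ f hf).2 hv⟩

theorem IsLocal.mono {A B : Sub ι} (hAB : A ≤ B) {h₀ : G} {f : S} (hf : h.IsLocal A h₀ f) :
    h.IsLocal B h₀ f :=
  let ⟨F, hFA, hF⟩ := hf
  ⟨F, hFA.trans hAB, hF⟩

theorem closure_mono {A B : Sub ι} (hAB : A ≤ B) : h.closure A ≤ h.closure B :=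
  closure_le fun _ _ hf => (hf.mono hAB).le_closure

theorem IsLocal.mem {A : Sub ι} {h₀ : G} {f : S} (hf : h.IsLocal A h₀ f) : h₀ ∈ A.verts :=
  let ⟨_, hFA, _, _, hv, _⟩ := hf
  hFA.1 hv

theorem IsLocal.mem_graph {A : Sub ι} {h₀ : G} {f : S} (_ : h.IsLocal A h₀ f) :
    h₀ ∈ ((h.graph f).translate h₀).verts := by
  rw [mem_verts_translate, inv_mul_cancel]
  exact h.one_mem_graph f

/-- Translates of Schützenberger graphs are closed. -/
theorem closure_le_translate_graph {A : Sub ι} {h₀ : G} {e : S} (he : e * e = e)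
    (hA : A ≤ (h.graph e).translate h₀) : h.closure A ≤ (h.graph e).translate h₀ :=
  closure_le fun _ _ ⟨_, hFA, _, _, hv, hc⟩ => hc.translate_graph_le he (hFA.trans hA) hv

/-- `F` itself is among the local pieces, and the graph it contributes is already closed. -/
theorem closure_eq {F : Sub ι} (hF : Q F) (hf : F.IsFinite) {v : G} (hv : v ∈ F.verts) {f : S}
    (hc : h.toIsPure.Covers (F.translate v⁻¹) f) : h.closure F = (h.graph f).translate v := by
  apply le_antisymm
  · apply closure_le_translate_graph hc.idem
    rw [← _root_.inv_inv v, ← translate_le_iff]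
    exact hc.le
  · exact IsLocal.le_closure ⟨F, le_rfl, hF, hf, hv, hc⟩

variable (h)

/-- The operator `c` is required to agree with `h.closure` on `Q` only, since a round trip through
`ClosureC` preserves no other values. -/
theorem cl_eq_graph (c : GClosure Q) (hcl : ∀ A, Q A → c.cl A = h.closure A)
    {F : Sub ι} {g : G} (hF : Pointed Q F g) {f : S}
    (hc : h.toIsPure.Covers F f) : c.cl F = h.graph f := by
  rw [hcl F hF.prop, closure_eq hF.prop hF.finite hF.one_mem
    (by simpa [translate_one] using hc), translate_one]

variable [Admissible Q]

theorem exists_covers {F : Sub ι} {g : G} (hF : Pointed Q F g) :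
    ∃ s, π s = g ∧ h.toIsPure.Covers F (src s) := by
  have hR : Multiplicative Q fun F g => ∃ s, π s = g ∧ h.toIsPure.Covers F (src s) :=
    { pair := fun g hg => by
        obtain ⟨m, hm, hmax⟩ := h.pair g hg
        exact ⟨m, hm, .pair hm hmax⟩
      letter := fun a => ⟨_, h.proj_letter a, .letter a⟩
      mul := by
        rintro A _ B _ ⟨s, rfl, hA⟩ ⟨t, rfl, hB⟩
        exact ⟨s * t, map_mul π s t, hA.mul hB⟩ }
  exact hR.induction hF

/-- Each vertex `π t` is tied to `1` by the finite subgraph covering `t`, so the graph is glued from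
pieces through `1`. -/
theorem prop_graph (e : S) : Q (h.graph e) := by
  refine Admissible.glue _ _ Admissible.vertex
    (pairSub_le_iff.2 ⟨h.one_mem_graph e, h.one_mem_graph e⟩) ?_
  rintro v ⟨t, rfl, ht⟩
  obtain ⟨F, hF, hc⟩ := h.cover t
  exact ⟨F, hc.le.trans (h.graph_anti ht), hF.prop, hF.mem, 1, Or.inl rfl, hF.one_mem⟩

theorem le_closure (A : Sub ι) : A ≤ h.closure A := by
  have key : ∀ F ≤ A, Q F → F.IsFinite → F ≤ h.closure A := by
    intro F hFA hF hf
    obtain ⟨v, hv⟩ := Admissible.nonempty F hF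
    obtain ⟨s, -, hs⟩ := h.exists_covers (Pointed.translate hF hf hv hv)
    refine le_trans ?_ (closure_mono hFA)
    rw [closure_eq hF hf hv hs, ← _root_.inv_inv v, ← translate_le_iff]
    exact hs.le
  constructor
  · intro v hv
    exact (key (pairSub ι v v) (pairSub_le_iff.2 ⟨hv, hv⟩) (Admissible.vertex' v)
      (pairSub_isFinite _ _)).1 (Or.inl rfl)
  · intro e he
    exact (key (edgeSub e) (edgeSub_le_iff.2 he) (Admissible.letter e)
      (edgeSub_isFinite _)).2 (Or.inl rfl)

theorem prop_closure {A : Sub ι} (hA : Q A) : Q (h.closure A) := by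
  refine Admissible.glue A _ hA (h.le_closure A) ?_
  rintro v ⟨h₀, f, hf, hv⟩
  exact ⟨_, hf.le_closure, Admissible.translate _ _ (h.prop_graph _), hv, h₀, hf.mem,
    hf.mem_graph⟩

/-- A finite subgraph of a closure lies in the closure of a finite subgraph. -/
theorem exists_finite_le_closure {A : Sub ι} (hA : Q A) {H : Sub ι} (hf : H.IsFinite)
    (hH : H ≤ h.closure A) : ∃ F ≤ A, Q F ∧ F.IsFinite ∧ H ≤ h.closure F := by
  -- Directedness: two finite pieces of `A` are joined through a finite link between a vertex of
  -- each.
  have join : ∀ F ≤ A, Q F → F.IsFinite → ∀ F' ≤ A, Q F' → F'.IsFinite →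
      ∃ E ≤ A, Q E ∧ E.IsFinite ∧ F ≤ E ∧ F' ≤ E := by
    intro F hFA hF hf F' hFA' hF' hf'
    obtain ⟨v, hv⟩ := Admissible.nonempty F hF
    obtain ⟨w, hw⟩ := Admissible.nonempty F' hF'
    obtain ⟨P, hPA, hP, hPf, hvP, hwP⟩ := Admissible.exists_finite hA (hFA.1 hv) (hFA'.1 hw)
    exact ⟨F ⊔ P ⊔ F', sup_le (sup_le hFA hPA) hFA',
      Admissible.sup (Admissible.sup hF hP hv hvP) hF' (Or.inr hwP) hw, (hf.sup hPf).sup hf',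
      le_sup_left.trans le_sup_left, le_sup_right⟩
  obtain ⟨v₀, hv₀⟩ := Admissible.nonempty A hA
  obtain ⟨E₀, hE₀A, hE₀, hE₀f, -⟩ := Admissible.exists_finite hA hv₀ hv₀
  have verts : ∃ F ≤ A, Q F ∧ F.IsFinite ∧ H.verts ⊆ (h.closure F).verts := by
    suffices ∀ D ⊆ H.verts, D.Finite → ∃ F ≤ A, Q F ∧ F.IsFinite ∧ D ⊆ (h.closure F).verts from
      this _ subset_rfl hf.1
    intro D hD hDf
    induction D, hDf using Set.Finite.induction_on with
    | empty => exact ⟨E₀, hE₀A, hE₀, hE₀f, Set.empty_subset _⟩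
    | insert _ _ ih =>
      obtain ⟨hv, hD⟩ := Set.insert_subset_iff.1 hD
      obtain ⟨F, hFA, hF, hFf, hDF⟩ := ih hD
      obtain ⟨h₀, f, ⟨F', hFA', hF', hFf', hvF', hc⟩, hv⟩ := hH.1 hv
      obtain ⟨E, hEA, hE, hEf, h1, h2⟩ := join F hFA hF hFf F' hFA' hF' hFf'
      exact ⟨E, hEA, hE, hEf, Set.insert_subset ⟨h₀, f, ⟨F', h2, hF', hFf', hvF', hc⟩, hv⟩
        (hDF.trans (closure_mono h1).1)⟩
  have edges : ∃ F ≤ A, Q F ∧ F.IsFinite ∧ H.edges ⊆ (h.closure F).edges := by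
    suffices ∀ D ⊆ H.edges, D.Finite → ∃ F ≤ A, Q F ∧ F.IsFinite ∧ D ⊆ (h.closure F).edges from
      this _ subset_rfl hf.2
    intro D hD hDf
    induction D, hDf using Set.Finite.induction_on with
    | empty => exact ⟨E₀, hE₀A, hE₀, hE₀f, Set.empty_subset _⟩
    | insert _ _ ih =>
      obtain ⟨hv, hD⟩ := Set.insert_subset_iff.1 hD
      obtain ⟨F, hFA, hF, hFf, hDF⟩ := ih hD
      obtain ⟨h₀, f, ⟨F', hFA', hF', hFf', hvF', hc⟩, hv⟩ := hH.2 hv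
      obtain ⟨E, hEA, hE, hEf, h1, h2⟩ := join F hFA hF hFf F' hFA' hF' hFf'
      exact ⟨E, hEA, hE, hEf, Set.insert_subset ⟨h₀, f, ⟨F', h2, hF', hFf', hvF', hc⟩, hv⟩
        (hDF.trans (closure_mono h1).2)⟩
  obtain ⟨V, hVA, hV, hVf, hHV⟩ := verts
  obtain ⟨E, hEA, hE, hEf, hHE⟩ := edges
  obtain ⟨F, hFA, hF, hFf, h1, h2⟩ := join V hVA hV hVf E hEA hE hEf
  exact ⟨F, hFA, hF, hFf, hHV.trans (closure_mono h1).1, hHE.trans (closure_mono h2).2⟩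

/-- A finite piece of the closure lies in the closure of a finite `E ≤ A`. The latter is a single
translate of a Schützenberger graph, and these are closed. -/
theorem closure_closure_le {A : Sub ι} (hA : Q A) : h.closure (h.closure A) ≤ h.closure A := by
  refine closure_le ?_
  rintro h₀ f ⟨F, hFA, hF, hFf, hv, hc⟩
  obtain ⟨E, hEA, hE, hEf, hFE⟩ := h.exists_finite_le_closure hA hFf hFA
  refine le_trans ?_ (closure_mono hEA)
  obtain ⟨w, hw⟩ := Admissible.nonempty E hE
  obtain ⟨s, -, hs⟩ := h.exists_covers (Pointed.translate hE hEf hw hw)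
  rw [closure_eq hE hEf hw hs] at hFE ⊢
  exact hc.translate_graph_le hs.idem hFE hv

theorem translate_closure_le (A : Sub ι) (g : G) :
    (h.closure A).translate g ≤ h.closure (A.translate g) := by
  rw [translate_le_iff]
  refine closure_le ?_
  rintro h₀ f ⟨F, hFA, hF, hFf, hv, hc⟩
  rw [← translate_le_iff, translate_comp]
  refine IsLocal.le_closure ⟨F.translate g, translate_mono hFA g, Admissible.translate _ _ hF,
    hFf.translate g, mem_verts_translate.2 (by simpa using hv), ?_⟩
  simpa [translate_comp] using hc

theorem closure_translate (A : Sub ι) (g : G) :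
    h.closure (A.translate g) = (h.closure A).translate g := by
  refine le_antisymm ?_ (h.translate_closure_le A g)
  have h3 := h.translate_closure_le (A.translate g) g⁻¹
  rw [translate_le_iff, translate_comp, inv_mul_cancel, translate_one, _root_.inv_inv] at h3
  exact h3

/-- The closure operator belonging to an inverse monoid, bundled. -/
def gClosure : GClosure Q where
  cl := h.closure
  prop _ := h.prop_closure
  le_cl A _ := h.le_closure A
  mono _ _ _ _ := closure_mono
  idem _ := h.closure_closure_le
  inv A g _ := h.closure_translate A g
  fin_verts := by
    rintro A _ v ⟨h₀, f, ⟨F, hFA, hF, hFf, h₀F, hc⟩, hv⟩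
    exact ⟨F, hFA, hF, hFf, h₀, f, ⟨F, le_rfl, hF, hFf, h₀F, hc⟩, hv⟩
  fin_edges := by
    rintro A _ v ⟨h₀, f, ⟨F, hFA, hF, hFf, h₀F, hc⟩, hv⟩
    exact ⟨F, hFA, hF, hFf, h₀, f, ⟨F, le_rfl, hF, hFf, h₀F, hc⟩, hv⟩

/-! ### Reconstruction of the monoid -/

variable (c : GClosure Q) (hcl : ∀ A, Q A → c.cl A = h.closure A)

/-- The morphism `s ↦ (graph (s * s⁻¹), π s)`. -/
def toMon : S →* c.Mon where
  toFun s := ⟨(h.graph (src s), π s), by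
    obtain ⟨F, hF, hc⟩ := h.cover s
    exact ⟨F, hF, (h.cl_eq_graph c hcl hF hc).symm⟩⟩
  map_one' := Subtype.ext <| Prod.ext (by
    refine (h.cl_eq_graph c hcl (Pointed.pair Admissible.vertex) ?_).symm
    refine .pair (map_one π) fun t ht => ?_
    rw [src_one, mul_one]) (map_one π)
  map_mul' s t := by
    obtain ⟨A, hA, hcA⟩ := h.cover s
    obtain ⟨B, hB, hcB⟩ := h.cover t
    refine Subtype.ext (Prod.ext ?_ (map_mul π s t))
    change h.graph (src (s * t)) = c.cl (h.graph (src s) ⊔ (h.graph (src t)).translate (π s))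
    rw [← h.cl_eq_graph c hcl hA hcA, ← h.cl_eq_graph c hcl hB hcB, GClosure.cl_mul hA hB,
      ← h.cl_eq_graph c hcl (hA.mul hB) (hcA.mul hcB)]

theorem toMon_eq {F : Sub ι} {s : S} (hF : Pointed Q F (π s))
    (hc : h.toIsPure.Covers F (src s)) : h.toMon c hcl s = GClosure.elt hF :=
  Subtype.ext (Prod.ext (h.cl_eq_graph c hcl hF hc).symm rfl)

theorem toMon_inv (s : S) : h.toMon c hcl s⁻¹ = (h.toMon c hcl s)⁻¹ := by
  obtain ⟨F, hF, hc⟩ := h.cover s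
  rw [h.toMon_eq c hcl hF hc, GClosure.elt_inv]
  refine Subtype.ext (Prod.ext ?_ (map_inv_group π s))
  exact (h.cl_eq_graph c hcl hF.inv (hc.inv hF.one_mem)).symm

theorem toMon_gen (x : X) : h.toMon c hcl (gen x) = c.gen x := by
  refine Subtype.ext (Prod.ext ?_ (h.proj_gen x))
  exact (h.cl_eq_graph c hcl (Pointed.letter (x, true)) (.letter (x, true))).symm

theorem toMon_pair {g : G} (hg : Q (pairSub ι 1 g)) {m : S} (hm : π m = g)
    (hmax : ∀ t, π t = g → src t * src m = src t) :
    h.toMon c hcl m = GClosure.elt (Pointed.pair hg) := by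
  refine Subtype.ext (Prod.ext ?_ hm)
  exact (h.cl_eq_graph c hcl (Pointed.pair hg) (.pair hm hmax)).symm

/-- The graph of `src s` determines `src s` as the largest idempotent covering a finite subgraph;
purity then recovers `s` from `src s` and `π s`. Surjectivity is `exists_covers`. -/
theorem toMon_bijective : Function.Bijective (h.toMon c hcl) := by
  constructor
  · intro s t hst
    obtain ⟨h1, h2⟩ := Prod.ext_iff.1 (congrArg Subtype.val hst)
    replace h1 : h.graph (src s) = h.graph (src t) := h1
    have key : ∀ {s t : S}, h.graph (src s) = h.graph (src t) → src s * src t = src s := by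
      intro s t hst
      obtain ⟨F, hF, hc⟩ := h.cover t
      rw [← hc.le_iff _ (src_idem s), hst]
      exact hc.le
    refine eq_of_src_eq π h.pure ?_ h2
    rw [← key h1, idem_comm (src_idem s) (src_idem t), key h1.symm]
  · intro a
    obtain ⟨F, g, hF, rfl⟩ := GClosure.exists_elt a
    obtain ⟨s, rfl, hc⟩ := h.exists_covers hF
    exact ⟨s, h.toMon_eq c hcl hF hc⟩

end IsModel

end Cayley

namespace Cayley

variable {X : Type u} {G : Type v} [Group G] {ι : X → G}

open Cayley.Sub InverseMonoid

/-! ### Connected subgraphs and `E`-unitary monoids -/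

section EUnitary

open Classical in
/-- An invariant finitary closure operator on connected subgraphs, as a map on all subgraphs. -/
noncomputable def ClosureC.toGClosure (c : ClosureC ι) : GClosure (IsConnected (ι := ι)) where
  cl A := if h : A.IsConnected then (c.1 ⟨A, h⟩).1 else A
  prop A h := by
    rw [dif_pos h]
    exact (c.1 ⟨A, h⟩).2
  le_cl A h := by
    rw [dif_pos h]
    exact c.1.le_closure ⟨A, h⟩
  mono A B hA hB hAB := by
    rw [dif_pos hA, dif_pos hB]
    exact c.1.monotone (show (⟨A, hA⟩ : CSub ι) ≤ ⟨B, hB⟩ from hAB)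
  idem A h := by
    rw [dif_pos h, dif_pos (c.1 ⟨A, h⟩).2]
    exact (c.1.idempotent ⟨A, h⟩).le
  inv A g h := by
    rw [dif_pos h, dif_pos (h.translate g)]
    exact congrArg Subtype.val (c.2.invariant g ⟨A, h⟩)
  fin_verts A h v hv := by
    rw [dif_pos h, c.2.finitary_verts] at hv
    obtain ⟨F, ⟨hFA, hF⟩, hv⟩ := Set.mem_iUnion₂.1 hv
    refine ⟨F.1, hFA, F.2, hF, ?_⟩
    rw [dif_pos F.2]
    exact hv
  fin_edges A h v hv := by
    rw [dif_pos h, c.2.finitary_edges] at hv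
    obtain ⟨F, ⟨hFA, hF⟩, hv⟩ := Set.mem_iUnion₂.1 hv
    refine ⟨F.1, hFA, F.2, hF, ?_⟩
    rw [dif_pos F.2]
    exact hv

theorem ClosureC.toGClosure_cl (c : ClosureC ι) (A : CSub ι) :
    c.toGClosure.cl A.1 = (c.1 A).1 := dif_pos A.2

theorem ClosureC.le_iff {c c' : ClosureC ι} : c ≤ c' ↔ c.toGClosure.LE c'.toGClosure := by
  constructor
  · intro h A hA
    rw [c.toGClosure_cl ⟨A, hA⟩, c'.toGClosure_cl ⟨A, hA⟩]
    exact h ⟨A, hA⟩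
  · intro h A
    have := h A.1 A.2
    rwa [toGClosure_cl, toGClosure_cl] at this

/-- The restriction of a closure to connected subgraphs. -/
def GClosure.toClosureC (k : GClosure (IsConnected (ι := ι))) : ClosureC ι :=
  ⟨{  toFun := fun A => ⟨k.cl A.1, k.prop _ A.2⟩
      monotone' := fun A B h => k.mono _ _ A.2 B.2 h
      le_closure' := fun A => k.le_cl _ A.2
      idempotent' := fun A => Subtype.ext (k.cl_cl A.2) },
    { invariant := fun g A => Subtype.ext (k.inv _ g A.2)
      finitary_verts := fun A => by
        apply subset_antisymm
        · intro v hv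
          obtain ⟨F, hFA, hF, hFf, hv⟩ := k.fin_verts _ A.2 v hv
          exact Set.mem_iUnion₂.2 ⟨⟨F, hF⟩, ⟨hFA, hFf⟩, hv⟩
        · exact Set.iUnion₂_subset fun F hF => (k.mono _ _ F.2 A.2 hF.1).1
      finitary_edges := fun A => by
        apply subset_antisymm
        · intro v hv
          obtain ⟨F, hFA, hF, hFf, hv⟩ := k.fin_edges _ A.2 v hv
          exact Set.mem_iUnion₂.2 ⟨⟨F, hF⟩, ⟨hFA, hFf⟩, hv⟩
        · exact Set.iUnion₂_subset fun F hF => (k.mono _ _ F.2 A.2 hF.1).2 }⟩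

/-- A connected edgeless graph is a single vertex, so conditions on edgeless pairs reduce to
conditions on `1`. -/
theorem elt_pair_eq_one {k : GClosure (IsConnected (ι := ι))} {g : G}
    (h : (pairSub ι 1 g).IsConnected) : (GClosure.elt (Pointed.pair h) : k.Mon) = 1 := by
  obtain rfl := eq_of_isConnected_pairSub h
  rfl

theorem exists_pointed_isConnected (hι : Subgroup.closure (Set.range ι) = ⊤) (g : G) :
    ∃ F, Pointed (IsConnected (ι := ι)) F g := by
  obtain ⟨F, -, h1, h2, h3, h4⟩ :=
    Admissible.exists_finite (isConnected_full hι) (v := 1) (w := g) trivial trivial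
  exact ⟨F, h1, h2, h3, h4⟩

/-- The `E`-unitary inverse monoid belonging to a closure operator on connected subgraphs. -/
noncomputable def ClosureC.toEUnitaryOver (hι : Subgroup.closure (Set.range ι) = ⊤)
    (c : ClosureC ι) : EUnitaryOver ι where
  carrier := c.toGClosure.Mon
  gen := c.toGClosure.gen
  generated := by
    intro T hgen hone hmul hinv
    refine Set.eq_univ_of_forall (GClosure.mem_of_closed T hgen (fun g hg => ?_) hmul hinv)
    rwa [elt_pair_eq_one hg]
  eUnitary := GClosure.isEUnitary
  proj := c.toGClosure.proj
  proj_gen x := rfl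
  proj_greatest :=
    ⟨GClosure.proj_surjective (exists_pointed_isConnected hι), GClosure.proj_eq_iff⟩

theorem _root_.EUnitaryOver.hom_subsingleton {S T : EUnitaryOver ι} (f g : S ⟶ T) : f = g := by
  apply EUnitaryOver.Hom.ext
  have h : {a | f.toMonoidHom a = g.toMonoidHom a} = Set.univ := by
    apply S.generated
    · intro x
      exact (f.map_gen x).trans (g.map_gen x).symm
    · exact (map_one f.toMonoidHom).trans (map_one g.toMonoidHom).symm
    · intro a ha b hb
      change f.toMonoidHom (a * b) = g.toMonoidHom (a * b)
      rw [map_mul, map_mul, ha, hb]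
    · intro a ha
      change f.toMonoidHom a⁻¹ = g.toMonoidHom a⁻¹
      rw [f.map_inv, g.map_inv, ha]
  exact MonoidHom.ext fun a => Set.eq_univ_iff_forall.1 h a

/-- The functor from closure operators on connected subgraphs to `E`-unitary inverse monoids. -/
noncomputable def toEUnitaryFunctor (hι : Subgroup.closure (Set.range ι) = ⊤) :
    ClosureC ι ⥤ EUnitaryOver ι where
  obj c := c.toEUnitaryOver hι
  map f :=
    { toMonoidHom := GClosure.map (ClosureC.le_iff.1 (leOfHom f))
      map_inv := GClosure.map_inv _
      map_gen := fun x => GClosure.map_elt _ (Pointed.letter (x, true)) }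
  map_id _ := EUnitaryOver.hom_subsingleton ..
  map_comp _ _ := EUnitaryOver.hom_subsingleton ..

theorem _root_.EUnitaryOver.isPure (S : EUnitaryOver ι) : IsPure ι S.gen S.proj where
  proj_gen := S.proj_gen
  pure s hs := (S.eUnitary s).1 ((S.proj_greatest.2 s 1).1 (by rw [hs, map_one]))

/-- The elements whose domain is covered by a pointed connected subgraph contain the generators and
are closed under the operations. -/
theorem _root_.EUnitaryOver.isModel (S : EUnitaryOver ι) :
    IsModel (IsConnected (ι := ι)) S.gen S.proj where
  toIsPure := S.isPure
  pair g hg := by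
    obtain rfl := eq_of_isConnected_pairSub hg
    exact ⟨1, map_one _, fun t _ => by rw [src_one, mul_one]⟩
  cover s := by
    have h : {s | ∃ F, Pointed (IsConnected (ι := ι)) F (S.proj s) ∧
        S.isPure.Covers F (src s)} = Set.univ := by
      apply S.generated
      · intro x
        refine ⟨_, ?_, .letter (x, true)⟩
        rw [show S.proj (S.gen x) = letterVal ι (x, true) from S.proj_gen x]
        exact .letter _
      · refine ⟨pairSub ι 1 1, ?_, .pair (map_one _) fun t _ => by rw [src_one, mul_one]⟩
        rw [map_one]
        exact .pair Admissible.vertex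
      · rintro a ⟨A, hA, hcA⟩ b ⟨B, hB, hcB⟩
        refine ⟨_, ?_, hcA.mul hcB⟩
        rw [map_mul]
        exact hA.mul hB
      · rintro a ⟨A, hA, hcA⟩
        refine ⟨_, ?_, hcA.inv hA.one_mem⟩
        rw [map_inv_group]
        exact hA.inv
    exact Set.eq_univ_iff_forall.1 h s

/-- A bijective canonical homomorphism is an isomorphism. -/
noncomputable def _root_.EUnitaryOver.isoOfBijective {S T : EUnitaryOver ι} (f : S ⟶ T)
    (hf : Function.Bijective f.toMonoidHom) : S ≅ T where
  hom := f
  inv :=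
    { toMonoidHom := (MulEquiv.ofBijective f.toMonoidHom hf).symm.toMonoidHom
      map_inv := fun a => hf.1 (by
        have key := (MulEquiv.ofBijective f.toMonoidHom hf).apply_symm_apply
        exact (key _).trans ((congrArg _ (key a).symm).trans (f.map_inv _).symm))
      map_gen := fun x => hf.1
        (((MulEquiv.ofBijective f.toMonoidHom hf).apply_symm_apply _).trans (f.map_gen x).symm) }
  hom_inv_id := EUnitaryOver.hom_subsingleton ..
  inv_hom_id := EUnitaryOver.hom_subsingleton ..

/-- Both categories are thin. Fullness is `GClosure.le_of_hom`, and `toMon` identifies each `S` with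
the image of its closure operator. -/
theorem toEUnitaryFunctor_isEquivalence (hι : Subgroup.closure (Set.range ι) = ⊤) :
    (toEUnitaryFunctor hι).IsEquivalence where
  faithful := ⟨fun _ => Subsingleton.elim _ _⟩
  full := ⟨fun {c c'} φ => by
    refine ⟨homOfLE (ClosureC.le_iff.2 ?_), EUnitaryOver.hom_subsingleton ..⟩
    refine GClosure.le_of_hom φ.toMonoidHom φ.map_inv φ.map_gen fun g hg => ?_
    rw [elt_pair_eq_one hg, elt_pair_eq_one hg]
    exact map_one φ.toMonoidHom⟩
  essSurj := ⟨fun S => by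
    let c := S.isModel.gClosure.toClosureC
    have hcl : ∀ A, A.IsConnected → c.toGClosure.cl A = S.isModel.closure A := fun A hA =>
      c.toGClosure_cl ⟨A, hA⟩
    let φ : S ⟶ (toEUnitaryFunctor hι).obj c :=
      { toMonoidHom := S.isModel.toMon c.toGClosure hcl
        map_inv := S.isModel.toMon_inv _ hcl
        map_gen := S.isModel.toMon_gen _ hcl }
    exact ⟨c, ⟨(EUnitaryOver.isoOfBijective φ (S.isModel.toMon_bijective _ hcl)).symm⟩⟩⟩

end EUnitary

/-! ### Arbitrary subgraphs and `F`-inverse monoids -/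

section FInverse

theorem isNonempty_or_eq_empty (A : Sub ι) : A.IsNonempty ∨ A = Sub.empty ι := by
  rcases A.verts.eq_empty_or_nonempty with h | h
  · right
    refine Sub.ext h (Set.eq_empty_of_forall_notMem fun e he => ?_)
    have := A.source_mem e he
    rw [h] at this
    exact this
  · exact .inl h

theorem empty_le (A : Sub ι) : Sub.empty ι ≤ A := ⟨fun _ h => h.elim, fun _ h => h.elim⟩

/-- An invariant finitary closure operator on subgraphs. -/
def ClosureS.toGClosure (c : ClosureS ι) : GClosure (IsNonempty (ι := ι)) where
  cl A := c.1 A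
  prop A h := h.mono (c.1.le_closure A).1
  le_cl A _ := c.1.le_closure A
  mono _ _ _ _ h := c.1.monotone h
  idem A _ := (c.1.idempotent A).le
  inv A g _ := c.2.invariant g A
  fin_verts A h v hv := by
    rw [c.2.finitary_verts] at hv
    obtain ⟨F, ⟨hFA, hF⟩, hv⟩ := Set.mem_iUnion₂.1 hv
    rcases isNonempty_or_eq_empty F with h | rfl
    · exact ⟨F, hFA, h, hF, hv⟩
    · rw [c.2.closed_empty] at hv
      exact hv.elim
  fin_edges A h v hv := by
    rw [c.2.finitary_edges] at hv
    obtain ⟨F, ⟨hFA, hF⟩, hv⟩ := Set.mem_iUnion₂.1 hv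
    rcases isNonempty_or_eq_empty F with h | rfl
    · exact ⟨F, hFA, h, hF, hv⟩
    · rw [c.2.closed_empty] at hv
      exact hv.elim

theorem ClosureS.le_iff {c c' : ClosureS ι} : c ≤ c' ↔ c.toGClosure.LE c'.toGClosure := by
  constructor
  · intro h A _
    exact h A
  · intro h A
    rcases isNonempty_or_eq_empty A with hA | rfl
    · exact h A hA
    · rw [c.2.closed_empty]
      exact empty_le _

/-- The maximal element over `g`. -/
def maxElt (k : GClosure (IsNonempty (ι := ι))) (g : G) : k.Mon :=
  GClosure.elt (Pointed.pair (g := g) ⟨1, Or.inl rfl⟩)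

/-- Larger subgraphs give smaller elements, and every subgraph pointed at `g` contains the edgeless
graph on `{1, g}`. -/
theorem natLE_maxElt {k : GClosure (IsNonempty (ι := ι))} (a : k.Mon) :
    NatLE a (maxElt k (k.proj a)) := by
  obtain ⟨A, g, hA, rfl⟩ := GClosure.exists_elt a
  rw [NatLE, GClosure.proj_elt, maxElt, GClosure.elt_inv, GClosure.elt_mul_elt,
    GClosure.elt_mul_elt]
  refine GClosure.elt_congr ?_ (by simp)
  rw [mul_inv_cancel, translate_one, translate_comp, mul_inv_cancel, translate_one, sup_idem]
  exact (sup_eq_left.2 (pairSub_le_iff.2 ⟨hA.one_mem, hA.mem⟩)).symm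

instance (k : GClosure (IsNonempty (ι := ι))) : FInverseMonoid k.Mon where
  maxElt a := maxElt k (k.proj a)
  maxElt_sigma a := (GClosure.proj_eq_iff _ _).1 rfl
  le_maxElt a b h := by
    rw [← (GClosure.proj_eq_iff _ _).2 h]
    exact natLE_maxElt b

/-- The `F`-inverse monoid belonging to a closure operator on subgraphs. -/
def ClosureS.toFInverseOver (hι : Subgroup.closure (Set.range ι) = ⊤) (c : ClosureS ι) : FInverseOver ι where
  carrier := c.toGClosure.Mon
  gen := c.toGClosure.gen
  generated := by
    intro T hgen hone hmul hinv hmax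
    have hpair : ∀ g, maxElt c.toGClosure g ∈ T := by
      -- As `ι(X)` generates `G`, the set `T` meets every fibre of the projection, and one
      -- application of `ᵐ` there yields the maximal element.
      have hproj : ∀ g, ∃ a ∈ T, c.toGClosure.proj a = g := by
        intro g
        have hg : g ∈ Subgroup.closure (Set.range ι) := hι ▸ Subgroup.mem_top g
        induction hg using Subgroup.closure_induction with
        | mem _ hx =>
          obtain ⟨x, rfl⟩ := hx
          exact ⟨_, hgen x, rfl⟩
        | one => exact ⟨1, hone, map_one _⟩
        | mul _ _ _ _ ha hb =>
          obtain ⟨a, ha, rfl⟩ := ha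
          obtain ⟨b, hb, rfl⟩ := hb
          exact ⟨_, hmul a ha b hb, map_mul _ _ _⟩
        | inv _ _ ha =>
          obtain ⟨a, ha, rfl⟩ := ha
          exact ⟨_, hinv a ha, map_inv_group _ _⟩
      intro g
      obtain ⟨a, ha, rfl⟩ := hproj g
      exact hmax a ha
    exact Set.eq_univ_of_forall
      (GClosure.mem_of_closed T hgen (fun g hg => hpair g) hmul hinv)
  proj := c.toGClosure.proj
  proj_gen x := rfl
  proj_greatest :=
    ⟨GClosure.proj_surjective fun _ => ⟨_, .pair ⟨1, Or.inl rfl⟩⟩, GClosure.proj_eq_iff⟩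

theorem _root_.FInverseOver.hom_subsingleton {S T : FInverseOver ι} (f g : S ⟶ T) : f = g := by
  apply FInverseOver.Hom.ext
  have h : {a | f.toMonoidHom a = g.toMonoidHom a} = Set.univ := by
    apply S.generated
    · intro x
      exact (f.map_gen x).trans (g.map_gen x).symm
    · exact (map_one f.toMonoidHom).trans (map_one g.toMonoidHom).symm
    · intro a ha b hb
      change f.toMonoidHom (a * b) = g.toMonoidHom (a * b)
      rw [map_mul, map_mul, ha, hb]
    · intro a ha
      change f.toMonoidHom a⁻¹ = g.toMonoidHom a⁻¹
      rw [f.map_inv, g.map_inv, ha]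
    · intro a ha
      change f.toMonoidHom (FInverseMonoid.maxElt a) = g.toMonoidHom (FInverseMonoid.maxElt a)
      rw [f.map_maxElt, g.map_maxElt, ha]
  exact MonoidHom.ext fun a => Set.eq_univ_iff_forall.1 h a

theorem _root_.FInverseOver.proj_maxElt (S : FInverseOver ι) (a : S.carrier) :
    S.proj (FInverseMonoid.maxElt a) = S.proj a :=
  (S.proj_greatest.2 _ _).2 (FInverseMonoid.maxElt_sigma a)

/-- Needed for fullness: a maximal element is determined by its projection, so morphisms match the
maximal elements over each `g`. -/
theorem _root_.FInverseOver.proj_hom {S T : FInverseOver ι} (f : S ⟶ T) (a : S.carrier) :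
    T.proj (f.toMonoidHom a) = S.proj a := by
  have h : {a | T.proj (f.toMonoidHom a) = S.proj a} = Set.univ := by
    apply S.generated
    · intro x
      change T.proj (f.toMonoidHom (S.gen x)) = S.proj (S.gen x)
      rw [f.map_gen, T.proj_gen, S.proj_gen]
    · change T.proj (f.toMonoidHom 1) = S.proj 1
      simp only [map_one]
    · intro a ha b hb
      change T.proj (f.toMonoidHom (a * b)) = S.proj (a * b)
      rw [map_mul, map_mul, map_mul, ha, hb]
    · intro a ha
      change T.proj (f.toMonoidHom a⁻¹) = S.proj a⁻¹
      rw [f.map_inv, map_inv_group, map_inv_group, ha]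
    · intro a ha
      change T.proj (f.toMonoidHom (FInverseMonoid.maxElt a)) =
        S.proj (FInverseMonoid.maxElt a)
      rw [f.map_maxElt, FInverseOver.proj_maxElt, FInverseOver.proj_maxElt, ha]
  exact Set.eq_univ_iff_forall.1 h a

/-- The functor from closure operators on subgraphs to `F`-inverse monoids. -/
def toFInverseFunctor (hι : Subgroup.closure (Set.range ι) = ⊤) :
    ClosureS ι ⥤ FInverseOver ι where
  obj c := c.toFInverseOver hι
  map f :=
    { toMonoidHom := GClosure.map (ClosureS.le_iff.1 (leOfHom f))
      map_inv := GClosure.map_inv _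
      map_maxElt := fun _ => GClosure.map_elt _ (.pair ⟨1, Or.inl rfl⟩)
      map_gen := fun x => GClosure.map_elt _ (Pointed.letter (x, true)) }
  map_id _ := FInverseOver.hom_subsingleton ..
  map_comp _ _ := FInverseOver.hom_subsingleton ..

/-- The greatest element over `1` is `1` itself, since it lies above `1`; so any `s` over `1` equals
`s s⁻¹`. -/
theorem _root_.FInverseOver.isPure (S : FInverseOver ι) : IsPure ι S.gen S.proj where
  proj_gen := S.proj_gen
  pure s hs := by
    have key : ∀ a : S.carrier, S.proj a = 1 → NatLE a (FInverseMonoid.maxElt 1) := fun a ha =>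
      FInverseMonoid.le_maxElt _ _ ((S.proj_greatest.2 a 1).1 (by rw [ha, map_one]))
    have h1 := key 1 (map_one _)
    rw [NatLE, one_inv, one_mul, one_mul] at h1
    have h2 := key s hs
    rw [NatLE, ← h1, mul_one] at h2
    rw [h2]
    exact src_idem s

theorem _root_.FInverseOver.src_le_src_maxElt (S : FInverseOver ι) {a b : S.carrier}
    (h : S.proj a = S.proj b) : src a * src (FInverseMonoid.maxElt b) = src a := by
  have h1 : a = src a * FInverseMonoid.maxElt b :=
    FInverseMonoid.le_maxElt b a ((S.proj_greatest.2 a b).1 h)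
  have h2 : src a = src a * src (FInverseMonoid.maxElt b) * src a := by
    conv_lhs => rw [h1, src_mul_eq, inv_eq_of_idem (src_idem a)]
  rw [mul_assoc, idem_comm (src_idem (FInverseMonoid.maxElt b)) (src_idem a), ← mul_assoc,
    src_idem] at h2
  exact h2.symm

/-- Compared with the `E`-unitary case, closure under `ᵐ` is new: the edgeless graph on `{1, g}`
covers the domain of the maximal element over `g`. -/
theorem _root_.FInverseOver.isModel (S : FInverseOver ι) :
    IsModel (IsNonempty (ι := ι)) S.gen S.proj where
  toIsPure := S.isPure
  pair g _ := by
    obtain ⟨a, rfl⟩ := S.proj_greatest.1 g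
    exact ⟨_, S.proj_maxElt a, fun t ht => S.src_le_src_maxElt ht⟩
  cover s := by
    have h : {s | ∃ F, Pointed (IsNonempty (ι := ι)) F (S.proj s) ∧
        S.isPure.Covers F (src s)} = Set.univ := by
      apply S.generated
      · intro x
        refine ⟨_, ?_, .letter (x, true)⟩
        rw [show S.proj (S.gen x) = letterVal ι (x, true) from S.proj_gen x]
        exact .letter _
      · refine ⟨pairSub ι 1 1, ?_, .pair (map_one _) fun t _ => by rw [src_one, mul_one]⟩
        rw [map_one]
        exact .pair Admissible.vertex
      · rintro a ⟨A, hA, hcA⟩ b ⟨B, hB, hcB⟩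
        refine ⟨_, ?_, hcA.mul hcB⟩
        rw [map_mul]
        exact hA.mul hB
      · rintro a ⟨A, hA, hcA⟩
        refine ⟨_, ?_, hcA.inv hA.one_mem⟩
        rw [map_inv_group]
        exact hA.inv
      · rintro a -
        exact ⟨_, .pair ⟨1, Or.inl rfl⟩,
          .pair rfl fun t ht => S.src_le_src_maxElt (ht.trans (S.proj_maxElt a))⟩
    exact Set.eq_univ_iff_forall.1 h s

/-- A bijective canonical homomorphism is an isomorphism. -/
noncomputable def _root_.FInverseOver.isoOfBijective {S T : FInverseOver ι} (f : S ⟶ T)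
    (hf : Function.Bijective f.toMonoidHom) : S ≅ T where
  hom := f
  inv :=
    { toMonoidHom := (MulEquiv.ofBijective f.toMonoidHom hf).symm.toMonoidHom
      map_inv := fun a => hf.1 (by
        have key := (MulEquiv.ofBijective f.toMonoidHom hf).apply_symm_apply
        exact (key _).trans ((congrArg _ (key a).symm).trans (f.map_inv _).symm))
      map_maxElt := fun a => hf.1 (by
        have key := (MulEquiv.ofBijective f.toMonoidHom hf).apply_symm_apply
        exact (key _).trans ((congrArg _ (key a).symm).trans (f.map_maxElt _).symm))
      map_gen := fun x => hf.1
        (((MulEquiv.ofBijective f.toMonoidHom hf).apply_symm_apply _).trans (f.map_gen x).symm) }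
  hom_inv_id := FInverseOver.hom_subsingleton ..
  inv_hom_id := FInverseOver.hom_subsingleton ..

/-- The extension by the empty subgraph of the closure operator of an `F`-inverse monoid. -/
def _root_.FInverseOver.closureS (S : FInverseOver ι) : ClosureS ι :=
  ⟨{  toFun := S.isModel.closure
      monotone' := fun _ _ h => IsModel.closure_mono h
      le_closure' := S.isModel.le_closure
      idempotent' := fun A => by
        refine le_antisymm ?_ (S.isModel.le_closure _)
        rcases isNonempty_or_eq_empty A with hA | rfl
        · exact S.isModel.closure_closure_le hA
        -- A local piece is based at a vertex of `A`, so the empty subgraph has none and its closure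
        -- is empty.
        · refine IsModel.closure_mono (IsModel.closure_le ?_)
          rintro h₀ f hf
          exact hf.mem.elim },
    { invariant := fun g A => S.isModel.closure_translate A g
      finitary_verts := fun A => by
        apply subset_antisymm
        · rintro v ⟨h₀, f, ⟨F, hFA, hF, hFf, hv, hc⟩, hvf⟩
          exact Set.mem_iUnion₂.2 ⟨F, ⟨hFA, hFf⟩, h₀, f, ⟨F, le_rfl, hF, hFf, hv, hc⟩, hvf⟩
        · exact Set.iUnion₂_subset fun F hF => (IsModel.closure_mono hF.1).1
      finitary_edges := fun A => by
        apply subset_antisymm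
        · rintro v ⟨h₀, f, ⟨F, hFA, hF, hFf, hv, hc⟩, hvf⟩
          exact Set.mem_iUnion₂.2 ⟨F, ⟨hFA, hFf⟩, h₀, f, ⟨F, le_rfl, hF, hFf, hv, hc⟩, hvf⟩
        · exact Set.iUnion₂_subset fun F hF => (IsModel.closure_mono hF.1).2
      closed_empty :=
        le_antisymm (IsModel.closure_le fun _ _ hf => hf.mem.elim) (empty_le _) }⟩

theorem toFInverseFunctor_isEquivalence (hι : Subgroup.closure (Set.range ι) = ⊤) :
    (toFInverseFunctor hι).IsEquivalence where
  faithful := ⟨fun _ => Subsingleton.elim _ _⟩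
  full := ⟨fun {c c'} φ => by
    refine ⟨homOfLE (ClosureS.le_iff.2 ?_), FInverseOver.hom_subsingleton ..⟩
    refine GClosure.le_of_hom φ.toMonoidHom φ.map_inv φ.map_gen fun g hg => ?_
    refine (φ.map_maxElt (maxElt c.toGClosure g)).trans ?_
    exact congrArg (maxElt c'.toGClosure) (FInverseOver.proj_hom φ (maxElt c.toGClosure g))⟩
  essSurj := ⟨fun S => by
    let c := S.closureS
    have hcl : ∀ A, A.IsNonempty → c.toGClosure.cl A = S.isModel.closure A := fun A hA => rfl
    let φ : S ⟶ (toFInverseFunctor hι).obj c :=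
      { toMonoidHom := S.isModel.toMon c.toGClosure hcl
        map_inv := S.isModel.toMon_inv _ hcl
        map_maxElt := fun a => (S.isModel.toMon_pair _ hcl ⟨1, Or.inl rfl⟩ (S.proj_maxElt a)
          fun t ht => S.src_le_src_maxElt ht)
        map_gen := S.isModel.toMon_gen _ hcl }
    exact ⟨c, ⟨(FInverseOver.isoOfBijective φ (S.isModel.toMon_bijective _ hcl)).symm⟩⟩⟩

end FInverse

end Cayley

theorem mainTheorem1 {X : Type u} {G : Type v} [Group G] (ι : X → G)
    (hι : Subgroup.closure (Set.range ι) = ⊤) :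
    Nonempty (EUnitaryOver ι ≌ Cayley.ClosureC ι) ∧
      Nonempty (FInverseOver ι ≌ Cayley.ClosureS ι) := by
  have := Cayley.toEUnitaryFunctor_isEquivalence hι
  have := Cayley.toFInverseFunctor_isEquivalence hι
  exact ⟨⟨(Cayley.toEUnitaryFunctor hι).asEquivalence.symm⟩,
    ⟨(Cayley.toFInverseFunctor hι).asEquivalence.symm⟩⟩
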